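/- **Non-linear pricing problem.** A seller faces a buyer whose type $\theta\in[\underline\theta,\overline\theta]\subset\mathbb R$ is drawn from an atomless probability distribution. A buyer of type $\theta$ who obtains quantity $q\in[0,1]$ at price $p$ has utility $v(q;\theta)-p$, where $v(\cdot;\theta)$ is concave on $[0,1]$ (not necessarily monotone), $v(0;\theta)=0$, and the single-crossing condition holds: $v(q_2;\theta_1)-v(q_1;\theta_1)<v(q_2;\theta_2)-v(q_1;\theta_2)$ for all $\theta_1<\theta_2$ and $q_1<q_2$. The seller pays a constant cost $c\ge 0$ for producing any non-zero quantity. A menu is a (possibly infinite) set of pairs $(q,p)$ with $q\in(0,1]$ and $p\in\mathbb R$; the item $(0,0)$ is always available in addition. Each type buys an available item that maximizes her utility, and the revenue of a menu for which this is possible (for almost every type) is the expected price paid minus the expected production cost. For $k\in\mathbb N\cup\{\infty\}$ let $\mathrm{OPT}_k$ be the supremum of the revenues of menus with at most $k$ distinct non-zero quantities ($k=\infty$: no restriction). **Computational model.** Algorithms are uniform programs of a real random access machine, which performs tests, memory accesses, additions, subtractions and multiplications of natural and of real numbers, and divisions of real numbers, each in one step. The input is $\lambda$, $\varepsilon$,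 $c$ and $k$. The instance is accessed through two kinds of queries, each costing one step: the probability that the type exceeds a given number, and, for two given items $(q',p')$ and $(q,p)$, the threshold type at which buyers start to prefer $(q,p)$ to $(q',p')$, i.e. the infimum of the types $\theta$ with $v(q;\theta)-p\ge v(q';\theta)-p'$ (and $\overline\theta$ if there is no such type). **Theorem.** There are a single algorithm and a polynomial $P$ such that for every instance, every $\lambda>0$ with $\frac{d}{dq}v(0;\theta)<\lambda$ for all types $\theta$ (one-sided derivative at $0$, which is assumed to exist), every $\varepsilon>0$ and every $k\in\mathbb N\cup\{\infty\}$, the algorithm halts after at most $P(\lambda,1/\varepsilon)$ steps and outputs a finite menu with at most $k$ distinct non-zero quantities whose revenue is well defined and at least $\mathrm{OPT}_k-\lambda\varepsilon$; moreover $\mathrm{OPT}_k$ is finite. -/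

import Mathlib

open Set MeasureTheory

namespace NonlinearPricing

/-! ### The non-linear pricing problem -/

/-- An instance of the non-linear pricing problem: `value q θ` is the value of a buyer of type
`θ ∈ [lo, hi]` for the quantity `q ∈ [0, 1]`, `prior` is the distribution of the buyer's type, and
`cost` is what the seller pays for producing any non-zero quantity. -/
structure Instance where
  value : ℝ → ℝ → ℝ
  lo : ℝ
  hi : ℝ
  prior : Measure ℝ
  cost : ℝ
  isProbabilityMeasure : IsProbabilityMeasure prior
  atomless : ∀ θ, prior {θ} = 0
  prior_compl : prior (Icc lo hi)ᶜ = 0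
  cost_nonneg : 0 ≤ cost
  concave : ∀ θ ∈ Icc lo hi, ConcaveOn ℝ (Icc 0 1) (fun q => value q θ)
  value_zero : ∀ θ ∈ Icc lo hi, value 0 θ = 0
  single_crossing : ∀ θ₁ ∈ Icc lo hi, ∀ θ₂ ∈ Icc lo hi, ∀ q₁ ∈ Icc (0 : ℝ) 1, ∀ q₂ ∈ Icc (0 : ℝ) 1,
    θ₁ < θ₂ → q₁ < q₂ → value q₂ θ₁ - value q₁ θ₁ < value q₂ θ₂ - value q₁ θ₂

/-- The (one-sided) derivative of every buyer's valuation at quantity `0` exists and is smaller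
than `lam`. -/
def Instance.MarginalBound (I : Instance) (lam : ℝ) : Prop :=
  ∀ θ ∈ Icc I.lo I.hi, ∃ d < lam, HasDerivWithinAt (fun q => I.value q θ) d (Icc 0 1) 0

/-- A menu is a (possibly infinite) set of pairs (quantity, price) with quantities in `(0, 1]`.
The trivial item `(0, 0)` is always available in addition, see `offers`. -/
def IsMenu (M : Set (ℝ × ℝ)) : Prop := ∀ z ∈ M, z.1 ∈ Ioc (0 : ℝ) 1

/-- What a buyer facing the menu `M` can choose from. -/
def offers (M : Set (ℝ × ℝ)) : Set (ℝ × ℝ) := insert (0, 0) M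

/-- The menu `M` has at most `k` quality levels besides the trivial one (`k = ⊤`: no constraint). -/
def HasAtMostLevels (M : Set (ℝ × ℝ)) (k : ℕ∞) : Prop := (Prod.fst '' M).encard ≤ k

/-- Utility of a buyer of type `θ` who obtains the quantity `z.1` at the price `z.2`. -/
def Instance.utility (I : Instance) (θ : ℝ) (z : ℝ × ℝ) : ℝ := I.value z.1 θ - z.2

/-- The seller's net revenue from selling the quantity `z.1` at the price `z.2`. -/
noncomputable def Instance.profit (I : Instance) (z : ℝ × ℝ) : ℝ :=
  z.2 - if 0 < z.1 then I.cost else 0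

/-- `x` describes purchases from the menu `M`: (almost) every type `θ` buys an item `x θ` that
maximizes her utility among everything that is offered. -/
def Instance.IsDemand (I : Instance) (M : Set (ℝ × ℝ)) (x : ℝ → ℝ × ℝ) : Prop :=
  AEMeasurable x I.prior ∧
    ∀ᵐ θ ∂I.prior, x θ ∈ offers M ∧ ∀ y ∈ offers M, I.utility θ y ≤ I.utility θ (x θ)

/-- `r` is the expected revenue of the menu `M` (under some way of breaking ties). -/
def Instance.IsRevenue (I : Instance) (M : Set (ℝ × ℝ)) (r : ℝ) : Prop :=
  ∃ x : ℝ → ℝ × ℝ, I.IsDemand M x ∧ r = ∫ θ, I.profit (x θ) ∂I.prior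

/-- All revenues that menus with at most `k` quality levels can achieve. -/
def Instance.revenues (I : Instance) (k : ℕ∞) : Set ℝ :=
  {r | ∃ M, IsMenu M ∧ HasAtMostLevels M k ∧ I.IsRevenue M r}

/-- The optimal revenue over menus with at most `k` quality levels. -/
noncomputable def Instance.opt (I : Instance) (k : ℕ∞) : ℝ := sSup (I.revenues k)

/-! ### Access to an instance -/

/-- The two queries about the instance that an algorithm may make. -/
structure Oracle where
  /-- the probability that the type exceeds a given number -/
  tail : ℝ → ℝ
  /-- the threshold type above which a given second item is preferred to a given first one -/
  cutoff : ℝ × ℝ → ℝ × ℝ → ℝ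

/-- `cutoff z w` is the infimum of the types that weakly prefer `w` to `z` (and `hi` if there are
none). If `z` has the smaller quantity, then all the types above it prefer `w` and all those below
it prefer `z`; a type that is indifferent between the two items equals the cutoff. -/
noncomputable def Instance.oracle (I : Instance) : Oracle where
  tail t := I.prior.real (Ioi t)
  cutoff z w := sInf (insert I.hi {θ ∈ Icc I.lo I.hi | I.utility θ z ≤ I.utility θ w})

/-! ### Algorithms: a real random access machine with unit costs

The memory consists of arrays of natural numbers and arrays of real numbers; a program mentions
finitely many of them. Programs are written in a small imperative language. -/

/-- `idx a i` and `real a i` are the `i`-th cells of the `a`-th array of natural numbers and of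
real numbers; `out` holds the menu items written so far. -/
structure State where
  idx : ℕ → ℕ → ℕ
  real : ℕ → ℕ → ℝ
  out : List (ℝ × ℝ)

/-- Expressions for natural numbers. -/
inductive IdxExpr where
  | const (n : ℕ)
  | get (a : ℕ) (i : IdxExpr)
  | add (e₁ e₂ : IdxExpr)
  | sub (e₁ e₂ : IdxExpr)
  | mul (e₁ e₂ : IdxExpr)

/-- Expressions for real numbers. -/
inductive RealExpr where
  | const (n : ℕ)
  | cast (e : IdxExpr)
  | get (a : ℕ) (i : IdxExpr)
  | add (e₁ e₂ : RealExpr)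
  | sub (e₁ e₂ : RealExpr)
  | mul (e₁ e₂ : RealExpr)
  | div (e₁ e₂ : RealExpr)
  | tail (t : RealExpr)
  | cutoff (q₁ p₁ q₂ p₂ : RealExpr)

/-- Tests. -/
inductive Test where
  | idxLe (e₁ e₂ : IdxExpr)
  | realLe (e₁ e₂ : RealExpr)
  | neg (b : Test)
  | both (b₁ b₂ : Test)

/-- Programs: `setIdx a i e` and `setReal a i e` write the value of `e` into the `i`-th cell of the
`a`-th array, and `emit q p` adds the item `(q, p)` to the output. -/
inductive Program where
  | skip
  | setIdx (a : ℕ) (i e : IdxExpr)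
  | setReal (a : ℕ) (i : IdxExpr) (e : RealExpr)
  | emit (q p : RealExpr)
  | seq (c₁ c₂ : Program)
  | ite (b : Test) (c₁ c₂ : Program)
  | loop (b : Test) (c : Program)

def IdxExpr.eval (s : State) : IdxExpr → ℕ
  | .const n => n
  | .get a i => s.idx a (i.eval s)
  | .add e₁ e₂ => e₁.eval s + e₂.eval s
  | .sub e₁ e₂ => e₁.eval s - e₂.eval s
  | .mul e₁ e₂ => e₁.eval s * e₂.eval s

noncomputable def RealExpr.eval (O : Oracle) (s : State) : RealExpr → ℝ
  | .const n => n
  | .cast e => (e.eval s : ℝ)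
  | .get a i => s.real a (i.eval s)
  | .add e₁ e₂ => e₁.eval O s + e₂.eval O s
  | .sub e₁ e₂ => e₁.eval O s - e₂.eval O s
  | .mul e₁ e₂ => e₁.eval O s * e₂.eval O s
  | .div e₁ e₂ => e₁.eval O s / e₂.eval O s
  | .tail t => O.tail (t.eval O s)
  | .cutoff q₁ p₁ q₂ p₂ => O.cutoff (q₁.eval O s, p₁.eval O s) (q₂.eval O s, p₂.eval O s)

def Test.Holds (O : Oracle) (s : State) : Test → Prop
  | .idxLe e₁ e₂ => e₁.eval s ≤ e₂.eval s
  | .realLe e₁ e₂ => e₁.eval O s ≤ e₂.eval O s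
  | .neg b => ¬ b.Holds O s
  | .both b₁ b₂ => b₁.Holds O s ∧ b₂.Holds O s

/-- Every operation and memory access costs one step. -/
def IdxExpr.cost : IdxExpr → ℕ
  | .const _ => 1
  | .get _ i => i.cost + 1
  | .add e₁ e₂ => e₁.cost + e₂.cost + 1
  | .sub e₁ e₂ => e₁.cost + e₂.cost + 1
  | .mul e₁ e₂ => e₁.cost + e₂.cost + 1

/-- Every operation, memory access and query costs one step. -/
def RealExpr.cost : RealExpr → ℕ
  | .const _ => 1
  | .cast e => e.cost + 1
  | .get _ i => i.cost + 1
  | .add e₁ e₂ => e₁.cost + e₂.cost + 1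
  | .sub e₁ e₂ => e₁.cost + e₂.cost + 1
  | .mul e₁ e₂ => e₁.cost + e₂.cost + 1
  | .div e₁ e₂ => e₁.cost + e₂.cost + 1
  | .tail t => t.cost + 1
  | .cutoff q₁ p₁ q₂ p₂ => q₁.cost + p₁.cost + q₂.cost + p₂.cost + 1

/-- Every operation, memory access and query costs one step. -/
def Test.cost : Test → ℕ
  | .idxLe e₁ e₂ => e₁.cost + e₂.cost + 1
  | .realLe e₁ e₂ => e₁.cost + e₂.cost + 1
  | .neg b => b.cost + 1
  | .both b₁ b₂ => b₁.cost + b₂.cost + 1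

def State.setIdx (s : State) (a i n : ℕ) : State :=
  { s with idx := Function.update s.idx a (Function.update (s.idx a) i n) }

noncomputable def State.setReal (s : State) (a i : ℕ) (r : ℝ) : State :=
  { s with real := Function.update s.real a (Function.update (s.real a) i r) }

def State.emit (s : State) (z : ℝ × ℝ) : State :=
  { s with out := z :: s.out }

/-- `Exec O c s s' t`: the program `c`, started in the state `s`, halts in the state `s'` after `t`
steps. -/
inductive Exec (O : Oracle) : Program → State → State → ℕ → Prop where
  | skip (s : State) : Exec O .skip s s 1
  | setIdx (a : ℕ) (i e : IdxExpr) (s : State) :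
      Exec O (.setIdx a i e) s (s.setIdx a (i.eval s) (e.eval s)) (i.cost + e.cost + 1)
  | setReal (a : ℕ) (i : IdxExpr) (e : RealExpr) (s : State) :
      Exec O (.setReal a i e) s (s.setReal a (i.eval s) (e.eval O s)) (i.cost + e.cost + 1)
  | emit (q p : RealExpr) (s : State) :
      Exec O (.emit q p) s (s.emit (q.eval O s, p.eval O s)) (q.cost + p.cost + 1)
  | seq {c₁ c₂ : Program} {s s' s'' : State} {t₁ t₂ : ℕ} :
      Exec O c₁ s s' t₁ → Exec O c₂ s' s'' t₂ → Exec O (.seq c₁ c₂) s s'' (t₁ + t₂)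
  | ite_true {b : Test} {c₁ c₂ : Program} {s s' : State} {t : ℕ} :
      b.Holds O s → Exec O c₁ s s' t → Exec O (.ite b c₁ c₂) s s' (b.cost + t + 1)
  | ite_false {b : Test} {c₁ c₂ : Program} {s s' : State} {t : ℕ} :
      ¬ b.Holds O s → Exec O c₂ s s' t → Exec O (.ite b c₁ c₂) s s' (b.cost + t + 1)
  | loop_true {b : Test} {c : Program} {s s' s'' : State} {t₁ t₂ : ℕ} :
      b.Holds O s → Exec O c s s' t₁ → Exec O (.loop b c) s' s'' t₂ →
      Exec O (.loop b c) s s'' (b.cost + t₁ + t₂ + 1)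
  | loop_false {b : Test} {c : Program} {s : State} :
      ¬ b.Holds O s → Exec O (.loop b c) s s (b.cost + 1)

/-- The input: array `0` of real numbers holds `lam`, `ε` and the cost; array `0` of natural
numbers holds `0` if the number of levels is unconstrained, and `1` and `k` if it is at most `k`.
Everything else is `0`, and nothing has been written to the output. -/
noncomputable def input (lam ε cost : ℝ) (k : ℕ∞) : State where
  idx a i := if a = 0 ∧ i = 0 then (if k = ⊤ then 0 else 1)
    else if a = 0 ∧ i = 1 then k.toNat else 0
  real a i := if a = 0 ∧ i = 0 then lam else if a = 0 ∧ i = 1 then ε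
    else if a = 0 ∧ i = 2 then cost else 0
  out := []

/-- The menu that has been written to the output. -/
def State.menu (s : State) : Set (ℝ × ℝ) := {z | z ∈ s.out}

end NonlinearPricing

namespace NonlinearPricing

/-! ### Cutoffs -/

/-! Single crossing reduces menus to chains: items of increasing quantity whose successive cutoffs
are weakly increasing. A type then buys the last item whose cutoff lies below her. This optimum is
unique except at the finitely many cutoffs, which are null because the prior is atomless. So the
revenue does not depend on tie-breaking, and it telescopes into the sum of (profit increment) *
P(type > cutoff); see `IsChain.integral_profit` and `IsChain.isRevenue_eq`. Each summand involves
two neighbours and admissibility involves three, so a best chain of grid items is found by a dynamic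
program indexed by the number of items still allowed and the last two items (`chainValue_le_dp`,
`isChain_trace`).

It remains to see that some grid chain loses only O(lam / m) against an arbitrary menu. Naive
rounding fails: a tiny change of utilities may send buyers to far less profitable items. Instead,
only the items whose profit is nearly a running maximum are kept, each price is cut by a fraction 1
/ m of the profit, and the result is rounded to a mesh of 1 / m ^ 2 in quantity and lam / m ^ 2 in
price. Moving to a larger kept item costs at most lam / m ^ 2 of profit. Moving to a smaller item
with profit lower by D forgoes a discount of D / m, while rounding can make up for at most 2 * lam /
m ^ 2, so D is at most 2 * lam / m (`profit_le_of_isMax`). Concavity controls the effect of rounding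
on utility differences (`value_sub_le_value_sub_add`). The rounded menu is finite, and its items
that are optimal for some type form a chain (`exists_chain_of_finite`); no step creates additional
quantities (`exists_grid_chain`).

The program takes m = ⌈8 / ε⌉. Grid and table have size polynomial in m, and loop invariants
identify the memory with the exact table. The table always covers m ^ 2 levels; k only decides where
the pointers are first read, so it does not affect the time bound. -/

theorem Instance.lo_le_hi (I : Instance) : I.lo ≤ I.hi := by
  by_contra h
  have := I.isProbabilityMeasure
  have h1 := I.prior_compl
  rw [Icc_eq_empty h, compl_empty, measure_univ] at h1
  exact one_ne_zero h1

theorem Instance.ae_mem_Icc (I : Instance) : ∀ᵐ θ ∂I.prior, θ ∈ Icc I.lo I.hi :=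
  I.prior_compl

theorem Instance.utility_lt_of_le (I : Instance) {θ₁ θ₂ : ℝ} {z w : ℝ × ℝ}
    (h₁ : θ₁ ∈ Icc I.lo I.hi) (h₂ : θ₂ ∈ Icc I.lo I.hi) (hz : z.1 ∈ Icc (0 : ℝ) 1)
    (hw : w.1 ∈ Icc (0 : ℝ) 1) (hzw : z.1 < w.1) (hθ : θ₁ < θ₂)
    (h : I.utility θ₁ z ≤ I.utility θ₁ w) : I.utility θ₂ z < I.utility θ₂ w := by
  have := I.single_crossing θ₁ h₁ θ₂ h₂ z.1 hz w.1 hw hθ hzw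
  unfold Instance.utility at *
  linarith

theorem Instance.bddBelow_prefer (I : Instance) (z w : ℝ × ℝ) :
    BddBelow (insert I.hi {θ ∈ Icc I.lo I.hi | I.utility θ z ≤ I.utility θ w}) := by
  refine ⟨I.lo, ?_⟩
  rintro θ (rfl | hθ)
  · exact I.lo_le_hi
  · exact hθ.1.1

theorem Instance.lo_le_cutoff (I : Instance) (z w : ℝ × ℝ) : I.lo ≤ I.oracle.cutoff z w := by
  refine le_csInf (insert_nonempty _ _) ?_
  rintro θ (rfl | hθ)
  · exact I.lo_le_hi
  · exact hθ.1.1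

theorem Instance.cutoff_le (I : Instance) {θ : ℝ} {z w : ℝ × ℝ} (hθ : θ ∈ Icc I.lo I.hi)
    (h : I.utility θ z ≤ I.utility θ w) : I.oracle.cutoff z w ≤ θ :=
  csInf_le (I.bddBelow_prefer z w) (Or.inr ⟨hθ, h⟩)

theorem Instance.cutoff_self (I : Instance) (z : ℝ × ℝ) : I.oracle.cutoff z z = I.lo :=
  le_antisymm (I.cutoff_le ⟨le_rfl, I.lo_le_hi⟩ le_rfl) (I.lo_le_cutoff z z)

/-- A type below θ that preferred `w` would, by single crossing, force θ to prefer `w` strictly. -/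
theorem Instance.le_cutoff (I : Instance) {θ : ℝ} {z w : ℝ × ℝ} (hθ : θ ∈ Icc I.lo I.hi)
    (hz : z.1 ∈ Icc (0 : ℝ) 1) (hw : w.1 ∈ Icc (0 : ℝ) 1) (hzw : z.1 < w.1)
    (h : I.utility θ w ≤ I.utility θ z) : θ ≤ I.oracle.cutoff z w := by
  refine le_csInf (insert_nonempty _ _) ?_
  rintro θ' (rfl | hθ')
  · exact hθ.2
  · by_contra! hlt
    exact absurd (I.utility_lt_of_le hθ'.1 hθ hz hw hzw hlt hθ'.2) (not_lt.2 h)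

theorem Instance.utility_lt_of_lt_cutoff (I : Instance) {θ : ℝ} {z w : ℝ × ℝ}
    (hθ : θ ∈ Icc I.lo I.hi) (h : θ < I.oracle.cutoff z w) :
    I.utility θ w < I.utility θ z := by
  by_contra! h'
  exact absurd (I.cutoff_le hθ h') (not_le.2 h)

theorem Instance.utility_lt_of_cutoff_lt (I : Instance) {θ : ℝ} {z w : ℝ × ℝ}
    (hθ : θ ∈ Icc I.lo I.hi) (hz : z.1 ∈ Icc (0 : ℝ) 1) (hw : w.1 ∈ Icc (0 : ℝ) 1)
    (hzw : z.1 < w.1) (h : I.oracle.cutoff z w < θ) : I.utility θ z < I.utility θ w := by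
  obtain ⟨θ', hθ', hlt⟩ := exists_lt_of_csInf_lt (insert_nonempty _ _) h
  rcases hθ' with rfl | hθ'
  · exact absurd hθ.2 (not_le.2 hlt)
  · exact I.utility_lt_of_le hθ'.1 hθ hz hw hzw hlt hθ'.2

/-! ### Chains of items -/

/-- The items in `l` follow `z` with increasing quantities and increasing cutoffs, all of which
are at least `s`. -/
def Instance.IsChain (I : Instance) : ℝ → ℝ × ℝ → List (ℝ × ℝ) → Prop
  | _, _, [] => True
  | s, z, w :: l => z.1 < w.1 ∧ w.1 ≤ 1 ∧ s ≤ I.oracle.cutoff z w ∧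
      Instance.IsChain I (I.oracle.cutoff z w) w l

/-- The expected profit, beyond that from `z`, of a chain of items following `z`. -/
noncomputable def Instance.chainValue (I : Instance) : ℝ × ℝ → List (ℝ × ℝ) → ℝ
  | _, [] => 0
  | z, w :: l => (I.profit w - I.profit z) * I.oracle.tail (I.oracle.cutoff z w) +
      Instance.chainValue I w l

open Classical in
/-- What type `θ` buys when she is offered `z` and a chain of items following `z`. -/
noncomputable def Instance.chainChoice (I : Instance) : ℝ × ℝ → List (ℝ × ℝ) → ℝ → ℝ × ℝ
  | z, [], _ => z
  | z, w :: l, θ => if I.oracle.cutoff z w < θ then Instance.chainChoice I w l θ else z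

/-- The cutoffs between neighbours in a chain of items. -/
noncomputable def Instance.chainCutoffs (I : Instance) : ℝ × ℝ → List (ℝ × ℝ) → List ℝ
  | _, [] => []
  | z, w :: l => I.oracle.cutoff z w :: Instance.chainCutoffs I w l

theorem Instance.IsChain.quantity_mem (I : Instance) {s : ℝ} {z : ℝ × ℝ} {l : List (ℝ × ℝ)}
    (h : I.IsChain s z l) : ∀ w ∈ l, z.1 < w.1 ∧ w.1 ≤ 1 := by
  induction l generalizing s z with
  | nil => simp
  | cons w l ih =>
    intro y hy
    rcases List.mem_cons.1 hy with rfl | hy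
    · exact ⟨h.1, h.2.1⟩
    · have := ih h.2.2.2 y hy
      exact ⟨h.1.trans this.1, this.2⟩

theorem Instance.chainChoice_mem (I : Instance) (z : ℝ × ℝ) (l : List (ℝ × ℝ)) (θ : ℝ) :
    I.chainChoice z l θ ∈ z :: l := by
  induction l generalizing z with
  | nil => simp [Instance.chainChoice]
  | cons w l ih =>
    unfold Instance.chainChoice
    split_ifs
    · exact List.mem_cons_of_mem _ (ih w)
    · simp

theorem Instance.measurable_chainChoice (I : Instance) (z : ℝ × ℝ) (l : List (ℝ × ℝ)) :
    Measurable (I.chainChoice z l) := by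
  induction l generalizing z with
  | nil => exact measurable_const
  | cons w l ih => exact Measurable.ite measurableSet_Ioi (ih w) measurable_const

/-- Below all cutoffs each item is worse than its predecessor, so the comparisons compose down to
the head. -/
theorem Instance.IsChain.utility_lt (I : Instance) {s : ℝ} {z : ℝ × ℝ} {l : List (ℝ × ℝ)}
    (h : I.IsChain s z l) {θ : ℝ} (hθ : θ ∈ Icc I.lo I.hi) (hs : θ < s) :
    ∀ w ∈ l, I.utility θ w < I.utility θ z := by
  induction l generalizing s z with
  | nil => simp
  | cons w l ih =>
    have hw := I.utility_lt_of_lt_cutoff hθ (hs.trans_le h.2.2.1)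
    intro y hy
    rcases List.mem_cons.1 hy with rfl | hy
    · exact hw
    · exact (ih h.2.2.2 (hs.trans_le h.2.2.1) y hy).trans hw

/-- Strictness is what makes the demand from a chain almost surely unique; comparing neighbours
suffices because the cutoffs are monotone. -/
theorem Instance.IsChain.utility_lt_chainChoice (I : Instance) {s : ℝ} {z : ℝ × ℝ}
    {l : List (ℝ × ℝ)} (h : I.IsChain s z l) (hz : z.1 ∈ Icc (0 : ℝ) 1) {θ : ℝ}
    (hθ : θ ∈ Icc I.lo I.hi) (hne : θ ∉ I.chainCutoffs z l) :
    ∀ w ∈ z :: l, w ≠ I.chainChoice z l θ → I.utility θ w < I.utility θ (I.chainChoice z l θ) := by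
  induction l generalizing s z with
  | nil => simp [Instance.chainChoice]
  | cons w l ih =>
    simp only [Instance.chainCutoffs, List.mem_cons, not_or] at hne
    have hw : w.1 ∈ Icc (0 : ℝ) 1 := ⟨hz.1.trans h.1.le, h.2.1⟩
    intro y hy hyne
    unfold Instance.chainChoice at hyne ⊢
    split_ifs at hyne ⊢ with hc
    · rcases List.mem_cons.1 hy with rfl | hy
      · have h1 := I.utility_lt_of_cutoff_lt hθ hz hw h.1 hc
        by_cases h2 : w = I.chainChoice w l θ
        · rwa [← h2]
        · exact h1.trans (ih h.2.2.2 hw hne.2 w (by simp) h2)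
      · exact ih h.2.2.2 hw hne.2 y hy hyne
    · have hc' : θ < I.oracle.cutoff z w := lt_of_le_of_ne (not_lt.1 hc) hne.1
      rcases List.mem_cons.1 hy with rfl | hy
      · exact absurd rfl hyne
      · have h1 := I.utility_lt_of_lt_cutoff hθ hc'
        rcases List.mem_cons.1 hy with rfl | hy
        · exact h1
        · exact (h.2.2.2.utility_lt I hθ hc' y hy).trans h1

theorem Instance.integrable_comp_chainChoice (I : Instance) (f : ℝ × ℝ → ℝ) (z : ℝ × ℝ)
    (l : List (ℝ × ℝ)) : Integrable (fun θ => f (I.chainChoice z l θ)) I.prior := by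
  have := I.isProbabilityMeasure
  induction l generalizing z with
  | nil => exact integrable_const (f z)
  | cons w l ih =>
    have : (fun θ => f (I.chainChoice z (w :: l) θ)) =
        (Ioi (I.oracle.cutoff z w)).piecewise (fun θ => f (I.chainChoice w l θ))
          (fun _ => f z) := by
      funext θ
      simp only [Instance.chainChoice, Set.piecewise, mem_Ioi]
      split_ifs <;> rfl
    rw [this]
    exact Integrable.piecewise measurableSet_Ioi (ih w).integrableOn (integrable_const _).integrableOn

theorem Instance.IsChain.chainChoice_eq (I : Instance) {s : ℝ} {z : ℝ × ℝ} {l : List (ℝ × ℝ)}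
    (h : I.IsChain s z l) {θ : ℝ} (hs : θ ≤ s) : I.chainChoice z l θ = z := by
  cases l with
  | nil => rfl
  | cons w l => exact if_neg (not_lt.2 (hs.trans h.2.2.1))

theorem Instance.IsChain.integral_profit (I : Instance) {s : ℝ} {z : ℝ × ℝ} {l : List (ℝ × ℝ)}
    (h : I.IsChain s z l) :
    ∫ θ, I.profit (I.chainChoice z l θ) ∂I.prior = I.profit z + I.chainValue z l := by
  have := I.isProbabilityMeasure
  induction l generalizing s z with
  | nil => simp [Instance.chainChoice, Instance.chainValue]
  | cons w l ih =>
    -- The chains headed by `z` and by `w` differ only up to the first cutoff, and there the second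
    -- one still stops at its head `w` because later cutoffs are no smaller.
    have h1 : ∀ θ, I.profit (I.chainChoice z (w :: l) θ) = I.profit (I.chainChoice w l θ) -
        (I.profit w - I.profit z) + (Ioi (I.oracle.cutoff z w)).indicator
          (fun _ => I.profit w - I.profit z) θ := by
      intro θ
      by_cases hc : I.oracle.cutoff z w < θ
      · simp [Instance.chainChoice, hc]
      · rw [h.2.2.2.chainChoice_eq I (not_lt.1 hc)]
        simp [Instance.chainChoice, hc]
    simp_rw [h1]
    have hi := I.integrable_comp_chainChoice I.profit w l
    have hi' : Integrable (fun θ => I.profit (I.chainChoice w l θ) - (I.profit w - I.profit z))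
      I.prior := hi.sub (integrable_const _)
    rw [integral_add hi' ((integrable_const _).indicator measurableSet_Ioi), integral_sub hi (integrable_const _),
      ih h.2.2.2, integral_indicator measurableSet_Ioi]
    simp only [integral_const, smul_eq_mul, Instance.chainValue, probReal_univ,
      MeasurableSet.univ, measureReal_restrict_apply, univ_inter, Instance.oracle]
    ring

theorem Instance.ae_notMem_chainCutoffs (I : Instance) (z : ℝ × ℝ) (l : List (ℝ × ℝ)) :
    ∀ᵐ θ ∂I.prior, θ ∉ I.chainCutoffs z l := by
  have : NullSingletonClass I.prior := ⟨I.atomless⟩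
  have h : {θ | θ ∈ I.chainCutoffs z l}.Finite := List.finite_toSet _
  rw [ae_iff]
  simpa only [not_not] using h.measure_zero I.prior

theorem offers_chain_menu (l : List (ℝ × ℝ)) (w : ℝ × ℝ) :
    w ∈ offers {z | z ∈ l} ↔ w ∈ ((0, 0) : ℝ × ℝ) :: l := by
  simp [offers]

theorem Instance.profit_zero (I : Instance) : I.profit (0, 0) = 0 := by
  simp [Instance.profit]

theorem Instance.IsChain.exists_isRevenue (I : Instance) {s : ℝ} {l : List (ℝ × ℝ)}
    (h : I.IsChain s (0, 0) l) : I.IsRevenue {z | z ∈ l} (I.chainValue (0, 0) l) := by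
  refine ⟨I.chainChoice (0, 0) l, ⟨(I.measurable_chainChoice _ _).aemeasurable, ?_⟩, ?_⟩
  · filter_upwards [I.ae_mem_Icc, I.ae_notMem_chainCutoffs (0, 0) l] with θ h1 h2
    refine ⟨(offers_chain_menu _ _).2 (I.chainChoice_mem _ _ _), fun y hy => ?_⟩
    by_cases h3 : y = I.chainChoice (0, 0) l θ
    · rw [← h3]
    · exact (h.utility_lt_chainChoice I (by simp) h1 h2 y ((offers_chain_menu _ _).1 hy) h3).le
  · rw [h.integral_profit I, I.profit_zero, zero_add]

theorem Instance.IsChain.isRevenue_eq (I : Instance) {s : ℝ} {l : List (ℝ × ℝ)}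
    (h : I.IsChain s (0, 0) l) {r : ℝ} (hr : I.IsRevenue {z | z ∈ l} r) :
    r = I.chainValue (0, 0) l := by
  obtain ⟨x, ⟨-, hx⟩, rfl⟩ := hr
  have h0 := h.integral_profit I
  rw [I.profit_zero, zero_add] at h0
  rw [← h0]
  refine integral_congr_ae ?_
  filter_upwards [I.ae_mem_Icc, I.ae_notMem_chainCutoffs (0, 0) l, hx] with θ h1 h2 h3
  have : x θ = I.chainChoice (0, 0) l θ := by
    by_contra h4
    refine absurd (h.utility_lt_chainChoice I (by simp) h1 h2 _
      ((offers_chain_menu _ _).1 h3.1) h4) (not_lt.2 (h3.2 _ ?_))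
    exact (offers_chain_menu _ _).2 (I.chainChoice_mem _ _ _)
  simp only [this]

/-! ### Concavity estimates -/

/-- By concavity the slope on [x, y] is at most the slope on [0, y], which is at most the derivative
at 0. -/
theorem Instance.MarginalBound.value_sub_le {I : Instance} {lam : ℝ} (h : I.MarginalBound lam)
    {θ : ℝ} (hθ : θ ∈ Icc I.lo I.hi) {x y : ℝ} (hx : 0 ≤ x) (hxy : x ≤ y) (hy : y ≤ 1) :
    I.value y θ - I.value x θ ≤ lam * (y - x) := by
  rcases hxy.eq_or_lt with rfl | hxy
  · simp
  obtain ⟨d, hd, hder⟩ := h θ hθ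
  have hc := I.concave θ hθ
  have h0 : (0 : ℝ) ∈ Icc (0 : ℝ) 1 := by simp
  have hy' : y ∈ Icc (0 : ℝ) 1 := ⟨hx.trans hxy.le, hy⟩
  have hx' : x ∈ Icc (0 : ℝ) 1 := ⟨hx, hxy.le.trans hy⟩
  have h1 : slope (fun q => I.value q θ) 0 y ≤ d :=
    hc.slope_le_of_hasDerivWithinAt h0 hy' (hx.trans_lt hxy) hder
  have h2 : slope (fun q => I.value q θ) y x ≤ slope (fun q => I.value q θ) y 0 :=
    hc.slope_anti hy' ⟨h0, (hx.trans_lt hxy).ne⟩ ⟨hx', hxy.ne⟩ hx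
  rw [slope_comm, slope_comm _ y 0, slope_def_field] at h2
  have h3 := (h2.trans h1).trans hd.le
  rwa [div_le_iff₀ (by linarith)] at h3

/-- Values themselves are not stable under rounding down, since a valuation may fall arbitrarily
steeply; only increments are controlled. Moving both endpoints left does not decrease the slope `s`,
and `s` lies in [0, lam] because the increment is nonnegative. The interval shrinks by at most δ,
which costs at most `s * δ`. -/
theorem Instance.MarginalBound.value_sub_le_value_sub_add {I : Instance} {lam : ℝ}
    (h : I.MarginalBound lam) (hlam : 0 ≤ lam) {θ : ℝ} (hθ : θ ∈ Icc I.lo I.hi)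
    {x y x' y' δ : ℝ} (hx' : 0 ≤ x') (hxx' : x' ≤ x) (hxy : x < y) (hy : y ≤ 1) (hyy' : y' ≤ y)
    (hx'y' : x' ≤ y') (hxδ : x ≤ x' + δ) (hyδ : y ≤ y' + δ)
    (hmono : I.value x θ ≤ I.value y θ) :
    I.value y θ - I.value x θ ≤ I.value y' θ - I.value x' θ + lam * δ := by
  have hδ : 0 ≤ δ := by linarith
  rcases hx'y'.eq_or_lt with rfl | hlt
  · have := h.value_sub_le hθ (hx'.trans hxx') hxy.le hy
    nlinarith
  have hc := I.concave θ hθ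
  have mx : x ∈ Icc (0 : ℝ) 1 := ⟨by linarith, by linarith⟩
  have my : y ∈ Icc (0 : ℝ) 1 := ⟨by linarith, by linarith⟩
  have mx' : x' ∈ Icc (0 : ℝ) 1 := ⟨by linarith, by linarith⟩
  have my' : y' ∈ Icc (0 : ℝ) 1 := ⟨by linarith, by linarith⟩
  have h1 : slope (fun q => I.value q θ) y x ≤ slope (fun q => I.value q θ) y x' :=
    hc.slope_anti my ⟨mx', by simp; linarith⟩ ⟨mx, hxy.ne⟩ hxx'
  have h2 : slope (fun q => I.value q θ) x' y ≤ slope (fun q => I.value q θ) x' y' :=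
    hc.slope_anti mx' ⟨my', hlt.ne'⟩ ⟨my, by simp; linarith⟩ hyy'
  rw [slope_comm, slope_comm _ y x'] at h1
  have h3 := h1.trans h2
  rw [slope_def_field, slope_def_field] at h3
  set s := (I.value y θ - I.value x θ) / (y - x) with hs
  have hs0 : 0 ≤ s := div_nonneg (by linarith) (by linarith)
  have hs1 : s ≤ lam := by
    rw [hs, div_le_iff₀ (by linarith)]
    exact h.value_sub_le hθ mx.1 hxy.le hy
  have hs2 : I.value y θ - I.value x θ = s * (y - x) := by
    rw [hs, div_mul_cancel₀ _ (by linarith)]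
  rw [le_div_iff₀ (by linarith)] at h3
  have h4 : s * (y - x) ≤ s * (y' - x' + δ) := mul_le_mul_of_nonneg_left (by linarith) hs0
  have h5 : s * δ ≤ lam * δ := mul_le_mul_of_nonneg_right hs1 hδ
  linarith

/-! ### Sets of purchased items -/

/-- Every item in `X` but the trivial one is bought by some type that may choose from all of `X`. -/
structure Instance.IsPurchased (I : Instance) (X : Set (ℝ × ℝ)) : Prop where
  zero_mem : (0, 0) ∈ X
  quantity_mem : ∀ z ∈ X, z.1 ∈ Icc (0 : ℝ) 1
  eq_zero : ∀ z ∈ X, z.1 = 0 → z = (0, 0)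
  exists_buyer : ∀ z ∈ X, z ≠ (0, 0) →
    ∃ θ ∈ Icc I.lo I.hi, ∀ w ∈ X, I.utility θ w ≤ I.utility θ z

theorem Instance.profit_of_pos (I : Instance) {z : ℝ × ℝ} (h : 0 < z.1) :
    I.profit z = z.2 - I.cost := by
  simp [Instance.profit, h]

theorem Instance.profit_le_price (I : Instance) (z : ℝ × ℝ) : I.profit z ≤ z.2 := by
  have := I.cost_nonneg
  unfold Instance.profit
  split_ifs <;> linarith

theorem Instance.utility_zero (I : Instance) {θ : ℝ} (hθ : θ ∈ Icc I.lo I.hi) :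
    I.utility θ (0, 0) = 0 := by
  simp [Instance.utility, I.value_zero θ hθ]

theorem Instance.MarginalBound.price_le {I : Instance} {lam : ℝ} (h : I.MarginalBound lam)
    {θ : ℝ} (hθ : θ ∈ Icc I.lo I.hi) {z : ℝ × ℝ} (hz : z.1 ∈ Icc (0 : ℝ) 1)
    (hu : I.utility θ (0, 0) ≤ I.utility θ z) : z.2 ≤ lam * z.1 := by
  have h1 := h.value_sub_le hθ le_rfl hz.1 hz.2
  rw [I.utility_zero hθ] at hu
  rw [I.value_zero θ hθ] at h1
  unfold Instance.utility at hu
  linarith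

namespace Instance.IsPurchased

variable {I : Instance} {X : Set (ℝ × ℝ)}

theorem price_le (hX : I.IsPurchased X) {lam : ℝ} (h : I.MarginalBound lam) {z : ℝ × ℝ}
    (hz : z ∈ X) : z.2 ≤ lam * z.1 := by
  by_cases h0 : z = (0, 0)
  · simp [h0]
  · obtain ⟨θ, hθ, hb⟩ := hX.exists_buyer z hz h0
    exact h.price_le hθ (hX.quantity_mem z hz) (hb _ hX.zero_mem)

theorem price_le_const (hX : I.IsPurchased X) {lam : ℝ} (h : I.MarginalBound lam)
    (hlam : 0 ≤ lam) {z : ℝ × ℝ} (hz : z ∈ X) : z.2 ≤ lam :=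
  (hX.price_le h hz).trans (mul_le_of_le_one_right hlam (hX.quantity_mem z hz).2)

theorem eq_of_quantity_eq (hX : I.IsPurchased X) {z w : ℝ × ℝ} (hz : z ∈ X) (hw : w ∈ X)
    (h : z.1 = w.1) : z = w := by
  by_cases hz0 : z = (0, 0)
  · rw [hz0] at h
    rw [hz0, hX.eq_zero w hw h.symm]
  by_cases hw0 : w = (0, 0)
  · rw [hw0] at h
    rw [hw0, hX.eq_zero z hz h]
  obtain ⟨θ, -, h1⟩ := hX.exists_buyer z hz hz0
  obtain ⟨θ', -, h2⟩ := hX.exists_buyer w hw hw0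
  have h1 := h1 w hw
  have h2 := h2 z hz
  unfold Instance.utility at h1 h2
  rw [h] at h1 h2
  exact Prod.ext h (by linarith)

/-- The type that buys `z` cannot lie above θ, who buys the larger `z₀`. She prefers `z` to the
smaller `w`, and single crossing passes this preference up to θ. -/
theorem utility_le (hX : I.IsPurchased X) {θ : ℝ} (hθ : θ ∈ Icc I.lo I.hi) {z₀ z w : ℝ × ℝ}
    (hz₀ : z₀ ∈ X) (hb : ∀ w ∈ X, I.utility θ w ≤ I.utility θ z₀) (hz : z ∈ X) (hw : w ∈ X)
    (hzz₀ : z.1 ≤ z₀.1) (hwz : w.1 < z.1) : I.utility θ w ≤ I.utility θ z := by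
  rcases hzz₀.eq_or_lt with heq | hlt
  · rw [hX.eq_of_quantity_eq hz hz₀ heq]
    exact hb w hw
  have hz0 : z ≠ (0, 0) := by
    rintro rfl
    exact absurd (hX.quantity_mem w hw).1 (not_le.2 hwz)
  obtain ⟨θ', hθ', hb'⟩ := hX.exists_buyer z hz hz0
  rcases lt_trichotomy θ θ' with hlt' | rfl | hlt'
  · exact absurd (I.utility_lt_of_le hθ hθ' (hX.quantity_mem z hz) (hX.quantity_mem z₀ hz₀) hlt hlt'
      (hb z hz)) (not_lt.2 (hb' z₀ hz₀))
  · exact hb' w hw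
  · exact (I.utility_lt_of_le hθ' hθ (hX.quantity_mem w hw) (hX.quantity_mem z hz) hwz hlt'
      (hb' w hw)).le

end Instance.IsPurchased

/-- The items in `X` whose profit is, up to `u`, at least that of all items with smaller
quantities. -/
def Instance.kept (I : Instance) (X : Set (ℝ × ℝ)) (u : ℝ) : Set (ℝ × ℝ) :=
  {z ∈ X | ∀ w ∈ X, w.1 < z.1 → I.profit w ≤ I.profit z + u}

/-- Among the items no larger than `z₀`, one whose profit is within `u` of the supremum qualifies.
The slack `u` is needed because `X` may be infinite and the supremum need not be attained. -/
theorem Instance.IsPurchased.exists_kept {I : Instance} {X : Set (ℝ × ℝ)} (hX : I.IsPurchased X)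
    {lam : ℝ} (h : I.MarginalBound lam) (hlam : 0 ≤ lam) {u : ℝ} (hu : 0 < u) {z₀ : ℝ × ℝ}
    (hz₀ : z₀ ∈ X) : ∃ z ∈ I.kept X u, z.1 ≤ z₀.1 ∧ I.profit z₀ ≤ I.profit z + u := by
  set S : Set ℝ := I.profit '' {w ∈ X | w.1 ≤ z₀.1}
  have hbdd : BddAbove S := by
    refine ⟨lam, ?_⟩
    rintro _ ⟨w, hw, rfl⟩
    exact (I.profit_le_price w).trans (hX.price_le_const h hlam hw.1)
  have hmem : I.profit z₀ ∈ S := ⟨z₀, ⟨hz₀, le_rfl⟩, rfl⟩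
  obtain ⟨_, ⟨z, hz, rfl⟩, hlt⟩ := exists_lt_of_lt_csSup ⟨_, hmem⟩ (sub_lt_self (sSup S) hu)
  refine ⟨z, ⟨hz.1, fun w hw hwz => ?_⟩, hz.2, ?_⟩
  · have := le_csSup hbdd (mem_image_of_mem I.profit
      (show w ∈ {w ∈ X | w.1 ≤ z₀.1} from ⟨hw, hwz.le.trans hz.2⟩))
    linarith
  · have := le_csSup hbdd hmem
    linarith

/-! ### Discounting and rounding -/

/-- The item `w` at a price that is reduced by a fraction `1 / m` of the profit, with the quantity
rounded down to a multiple of `1 / m ^ 2` and the price rounded up to a multiple of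
`lam / m ^ 2`. -/
noncomputable def Instance.roundItem (I : Instance) (lam : ℝ) (m : ℕ) (w : ℝ × ℝ) : ℝ × ℝ :=
  (⌊w.1 * (m : ℝ) ^ 2⌋₊ / (m : ℝ) ^ 2,
    ⌈(w.2 - I.profit w / m) / (lam / (m : ℝ) ^ 2)⌉₊ * (lam / (m : ℝ) ^ 2))

/-- The rounded menu. Items whose quantity would be rounded to zero are dropped. -/
def Instance.roundMenu (I : Instance) (lam : ℝ) (m : ℕ) (X : Set (ℝ × ℝ)) : Set (ℝ × ℝ) :=
  insert (0, 0) (I.roundItem lam m ''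
    {w ∈ I.kept X (lam / (m : ℝ) ^ 2) | 1 ≤ w.1 * (m : ℝ) ^ 2})

section Round

variable {I : Instance} {X : Set (ℝ × ℝ)} {lam : ℝ} {m : ℕ}

theorem Instance.IsPurchased.neg_le_profit (hX : I.IsPurchased X) {u : ℝ} (hu : 0 ≤ u)
    {w : ℝ × ℝ} (hw : w ∈ I.kept X u) : -u ≤ I.profit w := by
  rcases (hX.quantity_mem w hw.1).1.eq_or_lt with h | h
  · rw [hX.eq_zero w hw.1 h.symm, I.profit_zero]
    linarith
  · have := hw.2 _ hX.zero_mem h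
    rw [I.profit_zero] at this
    linarith

theorem nat_floor_div_bounds {x n : ℝ} (hx : 0 ≤ x) (hn : 0 < n) :
    0 ≤ ⌊x * n⌋₊ / n ∧ ⌊x * n⌋₊ / n ≤ x ∧ x ≤ ⌊x * n⌋₊ / n + 1 / n := by
  refine ⟨by positivity, ?_, ?_⟩
  · rw [div_le_iff₀ hn]
    exact Nat.floor_le (by positivity)
  · rw [← add_div, le_div_iff₀ hn]
    exact (Nat.lt_floor_add_one _).le

theorem nat_ceil_mul_bounds {x u : ℝ} (hu : 0 < u) (hx : -u ≤ x) :
    x ≤ ⌈x / u⌉₊ * u ∧ ⌈x / u⌉₊ * u ≤ x + u := by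
  have h1 : -1 ≤ x / u := by rw [le_div_iff₀ hu]; linarith
  have h2 : x / u * u = x := div_mul_cancel₀ _ hu.ne'
  constructor
  · calc x = x / u * u := h2.symm
      _ ≤ _ := mul_le_mul_of_nonneg_right (Nat.le_ceil _) hu.le
  · have h3 : (⌈x / u⌉₊ : ℝ) ≤ x / u + 1 := by
      -- The natural-number ceiling sends negative prices to 0, which raises them by at most `u`
      -- since `-u ≤ x`.
      rcases le_or_gt (x / u) 0 with h | h
      · rw [Nat.ceil_eq_zero.2 h, Nat.cast_zero]
        linarith
      · exact (Nat.ceil_lt_add_one h.le).le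
    calc _ ≤ (x / u + 1) * u := mul_le_mul_of_nonneg_right h3 hu.le
      _ = x + u := by rw [add_mul, h2, one_mul]

theorem div_sq_pos (hlam : 0 < lam) (hm : 0 < m) : 0 < lam / (m : ℝ) ^ 2 := by
  have : (0 : ℝ) < m := by exact_mod_cast hm
  positivity

theorem div_sq_le (hlam : 0 < lam) (hm : 0 < m) : lam / (m : ℝ) ^ 2 ≤ lam / m := by
  have : (1 : ℝ) ≤ m := by exact_mod_cast hm
  exact div_le_div_of_nonneg_left hlam.le (by linarith) (by nlinarith)

theorem Instance.IsPurchased.neg_le_discounted (hX : I.IsPurchased X) (hlam : 0 < lam)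
    (hm : 0 < m) {w : ℝ × ℝ} (hw : w ∈ I.kept X (lam / (m : ℝ) ^ 2)) :
    -(lam / (m : ℝ) ^ 2) ≤ w.2 - I.profit w / m := by
  have hu := div_sq_pos hlam hm
  have h1 := hX.neg_le_profit hu.le hw
  have h2 : (1 : ℝ) ≤ m := by exact_mod_cast hm
  have h3 := I.profit_le_price w
  rcases le_or_gt 0 (I.profit w) with h | h
  · have : I.profit w / m ≤ I.profit w := div_le_self h h2
    linarith
  · have : I.profit w / m ≤ 0 := div_nonpos_of_nonpos_of_nonneg h.le (by linarith)
    linarith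

theorem Instance.roundItem_quantity_pos (I : Instance) {w : ℝ × ℝ} (hm : 0 < m)
    (h : 1 ≤ w.1 * (m : ℝ) ^ 2) : 0 < (I.roundItem lam m w).1 := by
  have h1 : 0 < ⌊w.1 * (m : ℝ) ^ 2⌋₊ := Nat.floor_pos.2 h
  have h2 : (0 : ℝ) < ⌊w.1 * (m : ℝ) ^ 2⌋₊ := by exact_mod_cast h1
  have : (0 : ℝ) < m := by exact_mod_cast hm
  unfold Instance.roundItem
  positivity

/-- This treats the trivial item and the rounded items alike: only one-sided bounds on price and
profit are needed for the item that is finally bought. -/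
theorem Instance.IsPurchased.exists_of_mem_roundMenu (hX : I.IsPurchased X) (hlam : 0 < lam)
    (hm : 0 < m) {g : ℝ × ℝ} (hg : g ∈ I.roundMenu lam m X) :
    ∃ w ∈ I.kept X (lam / (m : ℝ) ^ 2), g.1 = ⌊w.1 * (m : ℝ) ^ 2⌋₊ / (m : ℝ) ^ 2 ∧
      w.2 - I.profit w / m ≤ g.2 ∧ I.profit w - I.profit w / m ≤ I.profit g := by
  rcases hg with rfl | ⟨w, ⟨hw, hw1⟩, rfl⟩
  · refine ⟨(0, 0), ⟨hX.zero_mem, fun w hw h => ?_⟩, by simp, by simp [I.profit_zero],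
      by simp [I.profit_zero]⟩
    exact absurd (hX.quantity_mem w hw).1 (not_le.2 h)
  · have h1 := (nat_ceil_mul_bounds (div_sq_pos hlam hm) (hX.neg_le_discounted hlam hm hw)).1
    refine ⟨w, hw, rfl, h1, ?_⟩
    have hw0 : 0 < w.1 := by
      by_contra! h
      have : w.1 * (m : ℝ) ^ 2 ≤ 0 := mul_nonpos_of_nonpos_of_nonneg h (by positivity)
      linarith
    rw [I.profit_of_pos (I.roundItem_quantity_pos hm hw1)]
    have h2 := I.profit_of_pos hw0
    have h3 : w.2 - I.profit w / m ≤ (I.roundItem lam m w).2 := h1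
    linarith

/-- The heart of the approximation. Here `z` is a kept substitute for the original purchase `z₀`,
and `w` is the kept item from which the new purchase `g` arises. Each case below loses at most 4 *
(lam / m), so the constant 8 is generous. -/
theorem Instance.IsPurchased.profit_le_of_isMax (hX : I.IsPurchased X) (h : I.MarginalBound lam)
    (hlam : 0 < lam) (hm : 0 < m) {θ : ℝ} (hθ : θ ∈ Icc I.lo I.hi) {z₀ g : ℝ × ℝ}
    (hz₀ : z₀ ∈ X) (hb : ∀ w ∈ X, I.utility θ w ≤ I.utility θ z₀)
    (hg : g ∈ I.roundMenu lam m X)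
    (hgb : ∀ y ∈ I.roundMenu lam m X, I.utility θ y ≤ I.utility θ g) :
    I.profit z₀ ≤ I.profit g + 8 * (lam / m) := by
  have hm' : (1 : ℝ) ≤ m := by exact_mod_cast hm
  have hm0 : (0 : ℝ) < m := by linarith
  have hn : (0 : ℝ) < (m : ℝ) ^ 2 := by positivity
  have hu := div_sq_pos hlam hm
  have hu' := div_sq_le hlam hm
  obtain ⟨z, hz, hzz₀, hprof⟩ := hX.exists_kept h hlam.le hu hz₀
  obtain ⟨w, hw, hg1, hg2, hgp⟩ := hX.exists_of_mem_roundMenu hlam hm hg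
  have hwu := hX.neg_le_profit hu.le hw
  have hzlam : I.profit z ≤ lam :=
    (I.profit_le_price z).trans (hX.price_le_const h hlam.le hz.1)
  -- The discount leaves at least the fraction 1 - 1 / m of the profit of `w`; as the profit of `z`
  -- is at most `lam`, this costs at most lam / m.
  have hscale : ∀ t : ℝ, I.profit z - t ≤ I.profit w → 0 ≤ t →
      I.profit z - t - lam / m ≤ I.profit g := by
    intro t ht ht0
    refine le_trans ?_ hgp
    have h1 : (I.profit z - t) * (1 - 1 / m) ≤ I.profit w * (1 - 1 / m) := by
      refine mul_le_mul_of_nonneg_right ht ?_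
      rw [sub_nonneg, div_le_one hm0]
      exact hm'
    have h2 : (I.profit z - t) / m ≤ lam / m := by gcongr; linarith
    have h3 : (I.profit z - t) * (1 - 1 / m) = I.profit z - t - (I.profit z - t) / m := by ring
    have h4 : I.profit w * (1 - 1 / m) = I.profit w - I.profit w / m := by ring
    linarith
  -- If `z` is dropped by the rounding, its quantity is below 1 / m ^ 2, so its profit is
  -- negligible, while that of `w` is at least -lam / m ^ 2.
  by_cases hz1 : 1 ≤ z.1 * (m : ℝ) ^ 2
  swap
  · have h1 : I.profit z ≤ lam / (m : ℝ) ^ 2 := by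
      refine ((I.profit_le_price z).trans (hX.price_le h hz.1)).trans ?_
      rw [le_div_iff₀ hn, mul_assoc]
      exact mul_le_of_le_one_right hlam.le (not_le.1 hz1).le
    have h2 := hscale (2 * (lam / (m : ℝ) ^ 2)) (by linarith) (by linarith)
    have h3 : -(lam / (m : ℝ) ^ 2) ≤ I.profit g := by
      refine le_trans ?_ hgp
      rcases le_or_gt 0 (I.profit w) with h | h
      · have : I.profit w / m ≤ I.profit w := div_le_self h hm'
        linarith
      · have : I.profit w / m ≤ 0 := div_nonpos_of_nonpos_of_nonneg h.le hm0.le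
        linarith
    linarith
  by_cases hcase : I.profit z - lam / (m : ℝ) ^ 2 ≤ I.profit w
  · have := hscale _ hcase hu.le
    linarith
  push Not at hcase
  -- A kept item larger than `z` cannot be this much less profitable than `z`.
  have hwz : w.1 < z.1 := by
    rcases lt_trichotomy w.1 z.1 with h | h | h
    · exact h
    · rw [hX.eq_of_quantity_eq hw.1 hz.1 h] at hcase
      linarith
    · have := hw.2 z hz.1 h
      linarith
  have hwq := hX.quantity_mem w hw.1
  have hzq := hX.quantity_mem z hz.1
  have hpz := I.profit_of_pos (hwq.1.trans_lt hwz)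
  have hpw : I.profit w = w.2 ∧ w.2 = 0 ∨ I.profit w = w.2 - I.cost := by
    rcases hwq.1.eq_or_lt with h | h
    · rw [hX.eq_zero w hw.1 h.symm]
      exact Or.inl ⟨I.profit_zero, rfl⟩
    · exact Or.inr (I.profit_of_pos h)
  have hcost := I.cost_nonneg
  -- Together with the preference for `z` over `w`, this makes the value increment from `w` to `z`
  -- nonnegative, as the concavity estimate requires.
  have hprice : w.2 ≤ z.2 := by
    rcases hpw with h | h
    · linarith [h.1]
    · linarith
  have hpref := hX.utility_le hθ hz₀ hb hz.1 hw.1 hzz₀ hwz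
  have hround := hgb _ (Or.inr (mem_image_of_mem _
    (show z ∈ {w ∈ I.kept X (lam / (m : ℝ) ^ 2) | 1 ≤ w.1 * (m : ℝ) ^ 2} from ⟨hz, hz1⟩)))
  unfold Instance.utility at hpref hround
  have hbw := nat_floor_div_bounds hwq.1 hn
  have hbz := nat_floor_div_bounds hzq.1 hn
  have hfl : (⌊w.1 * (m : ℝ) ^ 2⌋₊ : ℝ) / (m : ℝ) ^ 2 ≤ ⌊z.1 * (m : ℝ) ^ 2⌋₊ / (m : ℝ) ^ 2 := by
    gcongr
  have hconc := h.value_sub_le_value_sub_add hlam.le hθ hbw.1 hbw.2.1 hwz hzq.2 hbz.2.1 hfl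
    hbw.2.2 hbz.2.2 (by linarith)
  have hzr := (nat_ceil_mul_bounds hu (hX.neg_le_discounted hlam hm hz)).2
  simp only [Instance.roundItem] at hround
  rw [hg1] at hround
  -- Adding the original preference for `z` and the new preference for `g` leaves the difference of
  -- the discounts on one side. On the other are the two rounding errors, lam / m ^ 2 from
  -- quantities and lam / m ^ 2 from the price of `z`.
  have hkey : (I.profit z - I.profit w) / m ≤ 2 * (lam / (m : ℝ) ^ 2) := by
    rw [sub_div]
    have : lam * (1 / (m : ℝ) ^ 2) = lam / (m : ℝ) ^ 2 := by ring
    linarith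
  have hkey' : I.profit z - I.profit w ≤ 2 * (lam / m) := by
    rw [div_le_iff₀ hm0] at hkey
    refine hkey.trans (le_of_eq ?_)
    field_simp
  have hlm : 0 ≤ lam / m := by positivity
  have := hscale (2 * (lam / m)) (by linarith) (by linarith)
  linarith

end Round

/-! ### Near-optimal chains of grid items -/

/-- The number of grid prices. -/
def gridPrices (m : ℕ) : ℕ := m * m + 2

/-- The number of grid items. -/
def gridSize (m : ℕ) : ℕ := gridPrices m * (m * m + 1)

/-- The `i`-th item of the grid. -/
noncomputable def gridItem (lam : ℝ) (m i : ℕ) : ℝ × ℝ :=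
  ((i / gridPrices m : ℕ) / (m : ℝ) ^ 2, (i % gridPrices m : ℕ) * (lam / (m : ℝ) ^ 2))

theorem gridItem_zero (lam : ℝ) (m : ℕ) : gridItem lam m 0 = (0, 0) := by
  simp [gridItem]

theorem exists_gridItem_eq (lam : ℝ) {m i j : ℕ} (hi : i ≤ m * m) (hj : j < gridPrices m) :
    ∃ a < gridSize m, gridItem lam m a = (i / (m : ℝ) ^ 2, j * (lam / (m : ℝ) ^ 2)) := by
  have h0 : 0 < gridPrices m := by unfold gridPrices; omega
  refine ⟨j + gridPrices m * i, ?_, ?_⟩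
  · unfold gridSize
    nlinarith
  · unfold gridItem
    rw [Nat.add_mul_div_left _ _ h0, Nat.add_mul_mod_self_left, Nat.div_eq_of_lt hj,
      Nat.mod_eq_of_lt hj, zero_add]

theorem gridItem_quantity_mem (lam : ℝ) {m i : ℕ} (hm : 0 < m) (hi : i < gridSize m) :
    (gridItem lam m i).1 ∈ Icc (0 : ℝ) 1 := by
  have hm' : (0 : ℝ) < (m : ℝ) ^ 2 := by positivity
  have h : i / gridPrices m ≤ m * m := Nat.lt_succ_iff.1 (Nat.div_lt_of_lt_mul hi)
  refine ⟨by unfold gridItem; positivity, ?_⟩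
  unfold gridItem
  rw [div_le_one hm', sq]
  exact_mod_cast h

section Round

variable {I : Instance} {X : Set (ℝ × ℝ)} {lam : ℝ} {m : ℕ}

theorem Instance.IsPurchased.floor_le (hX : I.IsPurchased X) {w : ℝ × ℝ} (hw : w ∈ X) :
    ⌊w.1 * (m : ℝ) ^ 2⌋₊ ≤ m * m := by
  have h1 : w.1 * (m : ℝ) ^ 2 ≤ (m * m : ℕ) := by
    push_cast
    rw [← sq]
    exact mul_le_of_le_one_left (by positivity) (hX.quantity_mem w hw).2
  exact Nat.floor_le_of_le h1

theorem Instance.IsPurchased.exists_gridItem (hX : I.IsPurchased X) (h : I.MarginalBound lam)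
    (hlam : 0 < lam) (hm : 0 < m) {g : ℝ × ℝ} (hg : g ∈ I.roundMenu lam m X) :
    ∃ i < gridSize m, gridItem lam m i = g := by
  rcases hg with rfl | ⟨w, ⟨hw, -⟩, rfl⟩
  · exact ⟨0, by unfold gridSize gridPrices; positivity, gridItem_zero _ _⟩
  · refine exists_gridItem_eq lam (hX.floor_le hw.1) ?_
    have hu := div_sq_pos hlam hm
    have hm' : (1 : ℝ) ≤ m := by exact_mod_cast hm
    have h1 := hX.neg_le_profit hu.le hw
    have h2 : -(I.profit w / m) ≤ lam / (m : ℝ) ^ 2 := by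
      rw [← neg_div]
      exact (div_le_div_of_nonneg_right (by linarith) (by linarith)).trans
        (div_le_self hu.le hm')
    have h3 := hX.price_le_const h hlam.le hw.1
    -- A slightly negative profit turns the discount into a surcharge, so prices reach up to lam +
    -- lam / m ^ 2. This explains the m ^ 2 + 2 grid prices.
    have h4 : (w.2 - I.profit w / m) / (lam / (m : ℝ) ^ 2) ≤ (m * m + 1 : ℕ) := by
      rw [div_le_iff₀ hu]
      push_cast
      have : ((m : ℝ) * m + 1) * (lam / (m : ℝ) ^ 2) = lam + lam / (m : ℝ) ^ 2 := by
        field_simp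
      linarith
    have := Nat.ceil_le.2 h4
    unfold gridPrices
    omega

theorem Instance.IsPurchased.finite_roundMenu (hX : I.IsPurchased X) (h : I.MarginalBound lam)
    (hlam : 0 < lam) (hm : 0 < m) : (I.roundMenu lam m X).Finite := by
  refine ((finite_Iio (gridSize m)).image (gridItem lam m)).subset fun g hg => ?_
  obtain ⟨i, hi, rfl⟩ := hX.exists_gridItem h hlam hm hg
  exact mem_image_of_mem _ hi

/-- If θ finds `w` optimal, then θ is at or above the cutoff from `z` to `w` and at or below the
cutoff from `w` to any later item; hence the cutoffs increase. -/
theorem Instance.isChain_of_pairwise (I : Instance) {s : ℝ} {z : ℝ × ℝ} {l : List (ℝ × ℝ)}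
    (hz : z.1 ∈ Icc (0 : ℝ) 1) (hl : ∀ w ∈ l, w.1 ≤ 1)
    (hp : (z :: l).Pairwise (fun a b => a.1 < b.1))
    (hb : ∀ w ∈ l, ∃ θ ∈ Icc I.lo I.hi, ∀ y ∈ z :: l, I.utility θ y ≤ I.utility θ w)
    (hs : ∀ w ∈ l, s ≤ I.oracle.cutoff z w) : I.IsChain s z l := by
  induction l generalizing s z with
  | nil => trivial
  | cons w l ih =>
    rw [List.pairwise_cons] at hp
    have hzw := hp.1 w (by simp)
    have hw : w.1 ∈ Icc (0 : ℝ) 1 := ⟨hz.1.trans hzw.le, hl w (by simp)⟩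
    refine ⟨hzw, hw.2, hs w (by simp), ih hw (fun y hy => hl y (List.mem_cons_of_mem _ hy)) hp.2
      ?_ ?_⟩
    · intro y hy
      obtain ⟨θ, hθ, h⟩ := hb y (List.mem_cons_of_mem _ hy)
      exact ⟨θ, hθ, fun x hx => h x (List.mem_cons_of_mem _ hx)⟩
    · intro y hy
      obtain ⟨θ, hθ, h⟩ := hb w (by simp)
      have h1 := I.cutoff_le hθ (h z (by simp))
      have hwy := (List.pairwise_cons.1 hp.2).1 y hy
      exact h1.trans (I.le_cutoff hθ hw ⟨hw.1.trans hwy.le, hl y (List.mem_cons_of_mem _ hy)⟩ hwy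
        (h y (by simp [hy])))

theorem exists_sorted_list {G : Set (ℝ × ℝ)} (hG : G.Finite)
    (hinj : ∀ z ∈ G, ∀ w ∈ G, z.1 = w.1 → z = w) :
    ∃ l : List (ℝ × ℝ), l.Pairwise (fun a b => a.1 < b.1) ∧ ∀ w, w ∈ l ↔ w ∈ G := by
  classical
  set r : ℝ × ℝ → ℝ × ℝ → Prop := fun a b => a.1 ≤ b.1
  have : Std.Total r := ⟨fun a b => le_total a.1 b.1⟩
  have : IsTrans (ℝ × ℝ) r := ⟨fun a b c h1 h2 => le_trans h1 h2⟩
  have hmem : ∀ w, w ∈ hG.toFinset.toList.insertionSort r ↔ w ∈ G := by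
    intro w
    rw [List.mem_insertionSort, Finset.mem_toList, hG.mem_toFinset]
  refine ⟨hG.toFinset.toList.insertionSort r, ?_, hmem⟩
  have h1 := List.pairwise_insertionSort r hG.toFinset.toList
  have h2 : (hG.toFinset.toList.insertionSort r).Nodup :=
    (List.perm_insertionSort r _).nodup_iff.2 (Finset.nodup_toList _)
  refine List.Pairwise.imp_of_mem ?_ (h1.and h2)
  intro a b ha hb hab
  refine lt_of_le_of_ne hab.1 fun h => hab.2 (hinj a ((hmem a).1 ha) b ((hmem b).1 hb) h)

theorem length_le_of_pairwise {l : List (ℝ × ℝ)} (hp : l.Pairwise (fun a b => a.1 < b.1))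
    {S : Set ℝ} (hS : ∀ w ∈ l, w.1 ∈ S) : (l.length : ℕ∞) ≤ S.encard := by
  classical
  have h1 : (l.map Prod.fst).Nodup := by
    rw [List.nodup_iff_pairwise_ne, List.pairwise_map]
    exact hp.imp fun h => h.ne
  have h2 : ((l.map Prod.fst).toFinset : Set ℝ) ⊆ S := by
    intro q hq
    simp only [List.coe_toFinset, List.mem_map, mem_ofPred_eq] at hq
    obtain ⟨w, hw, rfl⟩ := hq
    exact hS w hw
  have h3 := Set.encard_le_encard h2
  rw [Set.encard_coe_eq_coe_finsetCard, List.toFinset_card_of_nodup h1, List.length_map] at h3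
  exact h3

/-- A finite menu contains a chain from which almost all types buy an item that is optimal in the
whole menu. -/
theorem Instance.exists_chain_of_finite (I : Instance) {G : Set (ℝ × ℝ)} (hG : G.Finite)
    (h0 : (0, 0) ∈ G) (hq : ∀ g ∈ G, g ≠ (0, 0) → g.1 ∈ Ioc (0 : ℝ) 1) :
    ∃ l : List (ℝ × ℝ), I.IsChain I.lo (0, 0) l ∧ l.Pairwise (fun a b => a.1 < b.1) ∧
      (∀ w ∈ l, w ∈ G ∧ w ≠ (0, 0)) ∧ ∀ᵐ θ ∂I.prior, ∀ y ∈ G,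
        I.utility θ y ≤ I.utility θ (I.chainChoice (0, 0) l θ) := by
  set C : Set (ℝ × ℝ) := {g ∈ G | g ≠ (0, 0) ∧
    ∃ θ ∈ Icc I.lo I.hi, ∀ y ∈ G, I.utility θ y ≤ I.utility θ g} with hC
  -- Two items of equal quantity that are each optimal for some type have the same price.
  obtain ⟨l, hl, hmem⟩ := exists_sorted_list (hG.subset (show C ⊆ G from fun g hg => hg.1)) (by
    rintro z ⟨hz, -, θ, -, h1⟩ w ⟨hw, -, θ', -, h2⟩ heq
    have h1 := h1 w hw
    have h2 := h2 z hz
    unfold Instance.utility at h1 h2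
    rw [heq] at h1 h2
    exact Prod.ext heq (by linarith))
  have hchain : I.IsChain I.lo (0, 0) l := by
    refine I.isChain_of_pairwise (by simp) ?_ ?_ ?_ ?_
    · intro w hw
      have hw := (hmem w).1 hw
      exact (hq w hw.1 hw.2.1).2
    · refine List.pairwise_cons.2 ⟨fun w hw => ?_, hl⟩
      have hw := (hmem w).1 hw
      exact (hq w hw.1 hw.2.1).1
    · intro w hw
      obtain ⟨-, -, θ, hθ, h⟩ := (hmem w).1 hw
      refine ⟨θ, hθ, fun y hy => h y ?_⟩
      rcases List.mem_cons.1 hy with rfl | hy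
      · exact h0
      · exact ((hmem y).1 hy).1
    · exact fun w _ => I.lo_le_cutoff _ _
  refine ⟨l, hchain, hl, fun w hw => ⟨((hmem w).1 hw).1, ((hmem w).1 hw).2.1⟩, ?_⟩
  filter_upwards [I.ae_mem_Icc, I.ae_notMem_chainCutoffs (0, 0) l] with θ hθ hne y hy
  obtain ⟨g, hg, hmax⟩ := exists_max_image G (I.utility θ) hG ⟨_, h0⟩
  refine (hmax y hy).trans ?_
  have hgl : g ∈ ((0, 0) : ℝ × ℝ) :: l := by
    by_cases hg0 : g = (0, 0)
    · simp [hg0]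
    · exact List.mem_cons_of_mem _ ((hmem g).2 ⟨hg, hg0, θ, hθ, hmax⟩)
  by_cases hgc : g = I.chainChoice (0, 0) l θ
  · rw [← hgc]
  · exact (hchain.utility_lt_chainChoice I (by simp) hθ hne g hgl hgc).le

/-- The items bought by the types in `T`, and the trivial item. -/
def purchases (x : ℝ → ℝ × ℝ) (T : Set ℝ) : Set (ℝ × ℝ) := insert (0, 0) (x '' T)

theorem IsMenu.quantity_mem {M : Set (ℝ × ℝ)} (hM : IsMenu M) {z : ℝ × ℝ} (hz : z ∈ offers M) :
    z.1 ∈ Icc (0 : ℝ) 1 := by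
  rcases hz with rfl | hz
  · simp
  · exact ⟨(hM z hz).1.le, (hM z hz).2⟩

theorem IsMenu.eq_zero {M : Set (ℝ × ℝ)} (hM : IsMenu M) {z : ℝ × ℝ} (hz : z ∈ offers M)
    (h : z.1 = 0) : z = (0, 0) := by
  rcases hz with rfl | hz
  · rfl
  · exact absurd h (hM z hz).1.ne'

theorem Instance.isPurchased_purchases (I : Instance) {M : Set (ℝ × ℝ)} (hM : IsMenu M)
    {x : ℝ → ℝ × ℝ} {T : Set ℝ} (hT : T ⊆ Icc I.lo I.hi)
    (hx : ∀ θ ∈ T, x θ ∈ offers M ∧ ∀ y ∈ offers M, I.utility θ y ≤ I.utility θ (x θ)) :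
    purchases x T ⊆ offers M ∧ I.IsPurchased (purchases x T) := by
  have hsub : purchases x T ⊆ offers M := by
    rintro z (rfl | ⟨θ, hθ, rfl⟩)
    · exact mem_insert _ _
    · exact (hx θ hθ).1
  refine ⟨hsub, mem_insert _ _, fun z hz => hM.quantity_mem (hsub hz),
    fun z hz => hM.eq_zero (hsub hz), ?_⟩
  rintro z (rfl | ⟨θ, hθ, rfl⟩) hne
  · exact absurd rfl hne
  · exact ⟨θ, hT hθ, fun w hw => (hx θ hθ).2 w (hsub hw)⟩

theorem Instance.exists_grid_chain (I : Instance) (h : I.MarginalBound lam) (hlam : 0 < lam)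
    (hm : 0 < m) {M : Set (ℝ × ℝ)} (hM : IsMenu M) {k : ℕ∞} (hk : HasAtMostLevels M k)
    {x : ℝ → ℝ × ℝ} (hx : I.IsDemand M x) (hi : Integrable (fun θ => I.profit (x θ)) I.prior) :
    ∃ l, I.IsChain I.lo (0, 0) l ∧ (l.length : ℕ∞) ≤ k ∧ l.length ≤ m * m ∧
      (∀ w ∈ l, ∃ i < gridSize m, gridItem lam m i = w) ∧
      ∫ θ, I.profit (x θ) ∂I.prior ≤ I.chainValue (0, 0) l + 8 * (lam / m) := by
  have := I.isProbabilityMeasure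
  set T : Set ℝ := {θ ∈ Icc I.lo I.hi | x θ ∈ offers M ∧
    ∀ y ∈ offers M, I.utility θ y ≤ I.utility θ (x θ)}
  obtain ⟨hsub, hX⟩ := I.isPurchased_purchases hM (T := T) (fun θ hθ => hθ.1) (fun θ hθ => hθ.2)
  obtain ⟨l, hl, hp, hmem, hopt⟩ := I.exists_chain_of_finite
    (hX.finite_roundMenu h hlam hm) (mem_insert _ _) (by
      rintro g (rfl | ⟨w, ⟨hw, hw1⟩, rfl⟩) hne
      · exact absurd rfl hne
      · refine ⟨I.roundItem_quantity_pos hm hw1, ?_⟩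
        have hn : (0 : ℝ) < (m : ℝ) ^ 2 := by positivity
        have hq := hX.quantity_mem w hw.1
        exact (nat_floor_div_bounds hq.1 hn).2.1.trans hq.2)
  refine ⟨l, hl, ?_, ?_, fun w hw => hX.exists_gridItem h hlam hm (hmem w hw).1, ?_⟩
  -- Every quantity in the chain is a rounded quantity of `M`, and rounding can only merge levels.
  · refine (length_le_of_pairwise hp (S := (fun q : ℝ => ⌊q * (m : ℝ) ^ 2⌋₊ / (m : ℝ) ^ 2) ''
      (Prod.fst '' M)) ?_).trans ((encard_image_le _ _).trans hk)
    intro w hw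
    obtain ⟨hw, hw0⟩ := hmem w hw
    rcases hw with rfl | ⟨z, ⟨hz, hz1⟩, rfl⟩
    · exact absurd rfl hw0
    · rcases hsub hz.1 with rfl | hzM
      · norm_num at hz1
      · exact ⟨z.1, mem_image_of_mem _ hzM, rfl⟩
  · have hle := length_le_of_pairwise hp (S := (fun j : ℕ => (j : ℝ) / (m : ℝ) ^ 2) ''
      (Finset.Icc 1 (m * m) : Finset ℕ)) ?_
    · have h2 := hle.trans (encard_image_le _ _)
      rw [encard_coe_eq_coe_finsetCard] at h2
      simp only [Nat.card_Icc, Nat.add_sub_cancel] at h2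
      exact_mod_cast h2
    intro w hw
    obtain ⟨hw, hw0⟩ := hmem w hw
    rcases hw with rfl | ⟨z, ⟨hz, hz1⟩, rfl⟩
    · exact absurd rfl hw0
    · exact ⟨⌊z.1 * (m : ℝ) ^ 2⌋₊, by
        simpa using ⟨hz1, hX.floor_le hz.1⟩, rfl⟩
  · have hchoice := hl.integral_profit I
    rw [I.profit_zero, zero_add] at hchoice
    have hint := I.integrable_comp_chainChoice I.profit (0, 0) l
    calc ∫ θ, I.profit (x θ) ∂I.prior
        ≤ ∫ θ, (I.profit (I.chainChoice (0, 0) l θ) + 8 * (lam / m)) ∂I.prior := by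
          refine integral_mono_ae hi (hint.add (integrable_const _)) ?_
          filter_upwards [I.ae_mem_Icc, hx.2, hopt] with θ h1 h2 h3
          have hθT : θ ∈ T := ⟨h1, h2⟩
          refine hX.profit_le_of_isMax h hlam hm h1 (Or.inr (mem_image_of_mem _ hθT))
            (fun w hw => h2.2 w (hsub hw)) ?_ h3
          rcases List.mem_cons.1 (I.chainChoice_mem (0, 0) l θ) with h4 | h4
          · rw [h4]
            exact mem_insert _ _
          · exact (hmem _ h4).1
      _ = _ := by
          rw [integral_add hint (integrable_const _), hchoice]
          simp

theorem Instance.bddAbove_revenues (I : Instance) (h : I.MarginalBound lam) (hlam : 0 < lam)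
    (k : ℕ∞) : BddAbove (I.revenues k) := by
  have := I.isProbabilityMeasure
  refine ⟨lam, ?_⟩
  rintro _ ⟨M, hM, -, x, hx, rfl⟩
  by_cases hi : Integrable (fun θ => I.profit (x θ)) I.prior
  · calc ∫ θ, I.profit (x θ) ∂I.prior ≤ ∫ _, lam ∂I.prior := by
          refine integral_mono_ae hi (integrable_const _) ?_
          filter_upwards [I.ae_mem_Icc, hx.2] with θ h1 h2
          have hq := hM.quantity_mem h2.1
          refine (I.profit_le_price _).trans
            ((h.price_le h1 hq (h2.2 _ (mem_insert _ _))).trans ?_)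
          exact mul_le_of_le_one_right hlam.le hq.2
      _ = lam := by simp
  · rw [integral_undef hi]
    exact hlam.le

theorem Instance.opt_le (I : Instance) (h : I.MarginalBound lam) (hlam : 0 < lam)
    (hm : 0 < m) {k : ℕ∞} {B : ℝ} (hB0 : 0 ≤ B)
    (hB : ∀ l, I.IsChain I.lo (0, 0) l → (l.length : ℕ∞) ≤ k → l.length ≤ m * m →
      (∀ w ∈ l, ∃ i < gridSize m, gridItem lam m i = w) → I.chainValue (0, 0) l ≤ B) :
    I.opt k ≤ B + 8 * (lam / m) := by
  have hlm : 0 ≤ lam / m := by positivity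
  refine Real.sSup_le ?_ (by linarith)
  rintro _ ⟨M, hM, hk, x, hx, rfl⟩
  -- A demand with non-integrable profit has integral 0 by convention; this is one use of `0 ≤ B`.
  by_cases hi : Integrable (fun θ => I.profit (x θ)) I.prior
  · obtain ⟨l, h1, h2, h3, h4, h5⟩ := I.exists_grid_chain h hlam hm hM hk hx hi
    have := hB l h1 h2 h3 h4
    linarith
  · rw [integral_undef hi]
    linarith

end Round

/-! ### The dynamic program -/

section Scan

open Classical in
/-- The largest positive value `val c` with `c < j` and `valid c`, and an index at which it is
attained, found by linear search. -/
noncomputable def scan (valid : ℕ → Prop) (val : ℕ → ℝ) : ℕ → ℝ × ℕ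
  | 0 => (0, 0)
  | j + 1 => if valid j ∧ ¬ val j ≤ (scan valid val j).1 then (val j, j) else scan valid val j

variable {valid : ℕ → Prop} {val : ℕ → ℝ}

theorem scan_nonneg (j : ℕ) : 0 ≤ (scan valid val j).1 := by
  induction j with
  | zero => exact le_rfl
  | succ j ih =>
    unfold scan
    split_ifs with h
    · exact ih.trans (not_le.1 h.2).le
    · exact ih

theorem le_scan {c j : ℕ} (hc : c < j) (hv : valid c) : val c ≤ (scan valid val j).1 := by
  induction j with
  | zero => omega
  | succ j ih =>
    unfold scan
    rcases Nat.lt_succ_iff_lt_or_eq.1 hc with hc | rfl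
    · split_ifs with h
      · exact (ih hc).trans (not_le.1 h.2).le
      · exact ih hc
    · split_ifs with h
      · exact le_rfl
      · by_contra h'
        exact h ⟨hv, h'⟩

theorem scan_cases (j : ℕ) : scan valid val j = (0, 0) ∨
    (scan valid val j).2 < j ∧ valid (scan valid val j).2 ∧
      (scan valid val j).1 = val (scan valid val j).2 := by
  induction j with
  | zero => exact Or.inl rfl
  | succ j ih =>
    unfold scan
    split_ifs with h
    · exact Or.inr ⟨Nat.lt_succ_self j, h.1, rfl⟩
    · exact ih.imp_right fun h => ⟨h.1.trans (Nat.lt_succ_self j), h.2⟩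

end Scan

/-- After the grid item `b`, preceded by `a`, a chain may continue with `c`. -/
def Instance.MayFollow (I : Instance) (lam : ℝ) (m a b c : ℕ) : Prop :=
  (gridItem lam m b).1 < (gridItem lam m c).1 ∧
    I.oracle.cutoff (gridItem lam m a) (gridItem lam m b) ≤
      I.oracle.cutoff (gridItem lam m b) (gridItem lam m c)

/-- The additional expected profit from the grid item `c` after `b`. -/
noncomputable def Instance.gain (I : Instance) (lam : ℝ) (m b c : ℕ) : ℝ :=
  (I.profit (gridItem lam m c) - I.profit (gridItem lam m b)) *
    I.oracle.tail (I.oracle.cutoff (gridItem lam m b) (gridItem lam m c))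

/-- The largest value of a chain of at most `l` grid items after `a` and `b`, and the first item of
such a chain (`0` if it is empty). -/
noncomputable def Instance.dp (I : Instance) (lam : ℝ) (m : ℕ) : ℕ → ℕ → ℕ → ℝ × ℕ
  | 0, _, _ => (0, 0)
  | l + 1, a, b => scan (I.MayFollow lam m a b)
      (fun c => I.gain lam m b c + (Instance.dp I lam m l b c).1) (gridSize m)

/-- The grid items that the pointers of the dynamic program lead to. -/
noncomputable def Instance.trace (I : Instance) (lam : ℝ) (m : ℕ) : ℕ → ℕ → ℕ → List (ℝ × ℝ)
  | 0, _, _ => []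
  | l + 1, a, b => if (I.dp lam m (l + 1) a b).2 = 0 then [] else
      gridItem lam m (I.dp lam m (l + 1) a b).2 ::
        Instance.trace I lam m l b (I.dp lam m (l + 1) a b).2

variable {I : Instance} {lam : ℝ} {m : ℕ}

theorem Instance.dp_nonneg (l a b : ℕ) : 0 ≤ (I.dp lam m l a b).1 := by
  cases l with
  | zero => exact le_rfl
  | succ l => exact scan_nonneg _

/-- The predecessor `a` enters only through the lower bound on the next cutoff. Starting with `a =
b` imposes no constraint, since the cutoff of an item against itself is `lo`. -/
theorem Instance.chainValue_le_dp {l a b : ℕ} {c : List (ℝ × ℝ)}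
    (hc : I.IsChain (I.oracle.cutoff (gridItem lam m a) (gridItem lam m b)) (gridItem lam m b) c)
    (hl : c.length ≤ l) (hg : ∀ w ∈ c, ∃ i < gridSize m, gridItem lam m i = w) :
    I.chainValue (gridItem lam m b) c ≤ (I.dp lam m l a b).1 := by
  induction c generalizing l a b with
  | nil => exact I.dp_nonneg _ _ _
  | cons w c ih =>
    cases l with
    | zero => simp at hl
    | succ l =>
      obtain ⟨i, hi, rfl⟩ := hg w (by simp)
      have h1 := ih hc.2.2.2 (Nat.le_of_succ_le_succ hl)
        (fun w hw => hg w (List.mem_cons_of_mem _ hw))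
      have h2 := le_scan (val := fun c => I.gain lam m b c + (I.dp lam m l b c).1) hi
        (show I.MayFollow lam m a b i from ⟨hc.1, hc.2.2.1⟩)
      exact (add_le_add_right h1 _).trans h2

theorem Instance.length_trace_le (l a b : ℕ) : (I.trace lam m l a b).length ≤ l := by
  induction l generalizing a b with
  | zero => exact le_rfl
  | succ l ih =>
    unfold Instance.trace
    split_ifs
    · simp
    · simpa using ih _ _

theorem Instance.isChain_trace (hm : 0 < m) {l a b : ℕ} (hb : b < gridSize m) :
    I.IsChain (I.oracle.cutoff (gridItem lam m a) (gridItem lam m b)) (gridItem lam m b)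
      (I.trace lam m l a b) ∧
    I.chainValue (gridItem lam m b) (I.trace lam m l a b) = (I.dp lam m l a b).1 := by
  induction l generalizing a b with
  | zero => exact ⟨trivial, rfl⟩
  | succ l ih =>
    unfold Instance.trace
    have hscan := scan_cases (valid := I.MayFollow lam m a b)
      (val := fun c => I.gain lam m b c + (I.dp lam m l b c).1) (gridSize m)
    change I.dp lam m (l + 1) a b = (0, 0) ∨ (I.dp lam m (l + 1) a b).2 < gridSize m ∧
      I.MayFollow lam m a b (I.dp lam m (l + 1) a b).2 ∧ (I.dp lam m (l + 1) a b).1 =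
        I.gain lam m b (I.dp lam m (l + 1) a b).2 +
          (I.dp lam m l b (I.dp lam m (l + 1) a b).2).1 at hscan
    rcases hscan with h | ⟨h1, h2, h3⟩
    · rw [h]
      exact ⟨trivial, rfl⟩
    · have h0 : (I.dp lam m (l + 1) a b).2 ≠ 0 := by
        intro h0
        have := h2.1
        rw [h0, gridItem_zero] at this
        exact absurd (gridItem_quantity_mem lam hm hb).1 (not_le.2 this)
      rw [if_neg h0]
      obtain ⟨h4, h5⟩ := ih (a := b) h1
      refine ⟨⟨h2.1, (gridItem_quantity_mem lam hm h1).2, h2.2, h4⟩, ?_⟩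
      rw [h3, ← h5]
      rfl

theorem gridSize_pos (m : ℕ) : 0 < gridSize m := by
  unfold gridSize gridPrices
  positivity

/-- The pointers of the dynamic program lead to a near-optimal menu. -/
theorem Instance.trace_spec (h : I.MarginalBound lam) (hlam : 0 < lam) (hm : 0 < m) {k : ℕ∞}
    {L : ℕ} (hLk : (L : ℕ∞) ≤ k) (hL : ∀ j : ℕ, (j : ℕ∞) ≤ k → j ≤ m * m → j ≤ L) :
    IsMenu {z | z ∈ I.trace lam m L 0 0} ∧ HasAtMostLevels {z | z ∈ I.trace lam m L 0 0} k ∧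
      (∃ r, I.IsRevenue {z | z ∈ I.trace lam m L 0 0} r) ∧
      ∀ r, I.IsRevenue {z | z ∈ I.trace lam m L 0 0} r → I.opt k - 8 * (lam / m) ≤ r := by
  obtain ⟨hc, hv⟩ := I.isChain_trace (lam := lam) hm (l := L) (a := 0) (gridSize_pos m)
  rw [I.cutoff_self, gridItem_zero] at hc
  rw [gridItem_zero] at hv
  refine ⟨fun w hw => ?_, ?_, ⟨_, hc.exists_isRevenue I⟩, fun r hr => ?_⟩
  · exact hc.quantity_mem I w hw
  · classical
    have h1 : Prod.fst '' {z | z ∈ I.trace lam m L 0 0} ⊆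
        (((I.trace lam m L 0 0).map Prod.fst).toFinset : Set ℝ) := by
      rintro _ ⟨w, hw, rfl⟩
      simpa using ⟨_, hw⟩
    refine (encard_le_encard h1).trans (le_trans ?_ hLk)
    rw [encard_coe_eq_coe_finsetCard]
    refine Nat.cast_le.2 ((List.toFinset_card_le _).trans ?_)
    rw [List.length_map]
    exact I.length_trace_le _ _ _
  · rw [hc.isRevenue_eq I hr, hv, sub_le_iff_le_add]
    refine I.opt_le h hlam hm (I.dp_nonneg _ _ _) fun c h1 h2 h3 h4 => ?_
    have := I.chainValue_le_dp (lam := lam) (m := m) (a := 0) (b := 0) (c := c) (l := L)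
    rw [I.cutoff_self, gridItem_zero] at this
    exact this h1 (hL _ h2 h3) h4

/-! ### Running programs -/

/-- The program `c`, started in the state `s`, halts in the state `s'` after at most `T` steps. -/
def Reach (O : Oracle) (c : Program) (s s' : State) (T : ℕ) : Prop :=
  ∃ t ≤ T, Exec O c s s' t

theorem Reach.seq {O : Oracle} {c₁ c₂ : Program} {s s' s'' : State} {T₁ T₂ : ℕ}
    (h₁ : Reach O c₁ s s' T₁) (h₂ : Reach O c₂ s' s'' T₂) :
    Reach O (.seq c₁ c₂) s s'' (T₁ + T₂) := by
  obtain ⟨t₁, ht₁, h₁⟩ := h₁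
  obtain ⟨t₂, ht₂, h₂⟩ := h₂
  exact ⟨t₁ + t₂, add_le_add ht₁ ht₂, .seq h₁ h₂⟩

theorem Reach.mono {O : Oracle} {c : Program} {s s' : State} {T T' : ℕ}
    (h : Reach O c s s' T) (hT : T ≤ T') : Reach O c s s' T' := by
  obtain ⟨t, ht, h⟩ := h
  exact ⟨t, ht.trans hT, h⟩

/-- A loop that passes through the states `S 0`, …, `S B`. -/
theorem Reach.loop {O : Oracle} {b : Test} {c : Program} {T : ℕ} (S : ℕ → State) (B : ℕ)
    (hb : ∀ j ≤ B, b.Holds O (S j) ↔ j < B)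
    (hc : ∀ j < B, Reach O c (S j) (S (j + 1)) T) :
    Reach O (.loop b c) (S 0) (S B) (B * (b.cost + T + 1) + (b.cost + 1)) := by
  have key : ∀ i j, i + j = B →
      Reach O (.loop b c) (S i) (S B) (j * (b.cost + T + 1) + (b.cost + 1)) := by
    intro i j
    induction j generalizing i with
    | zero =>
      intro h
      obtain rfl : i = B := h
      exact ⟨_, by simp, .loop_false (by simp [hb])⟩
    | succ j ih =>
      intro h
      obtain ⟨t₁, ht₁, h₁⟩ := hc i (by omega)
      obtain ⟨t₂, ht₂, h₂⟩ := ih (i + 1) (by omega)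
      refine ⟨_, ?_, .loop_true ((hb i (by omega)).2 (by omega)) h₁ h₂⟩
      rw [add_mul]
      omega
  exact key 0 B (zero_add B)

/-- Programs without loops. -/
def Program.LoopFree : Program → Prop
  | .seq c₁ c₂ => c₁.LoopFree ∧ c₂.LoopFree
  | .ite _ c₁ c₂ => c₁.LoopFree ∧ c₂.LoopFree
  | .loop _ _ => False
  | _ => True

open Classical in
/-- The final state of a program without loops. -/
noncomputable def Program.run (O : Oracle) : Program → State → State
  | .skip, s => s
  | .setIdx a i e, s => s.setIdx a (i.eval s) (e.eval s)
  | .setReal a i e, s => s.setReal a (i.eval s) (e.eval O s)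
  | .emit q p, s => s.emit (q.eval O s, p.eval O s)
  | .seq c₁ c₂, s => c₂.run O (c₁.run O s)
  | .ite b c₁ c₂, s => if b.Holds O s then c₁.run O s else c₂.run O s
  | .loop _ _, s => s

/-- A bound on the number of steps of a program without loops. -/
def Program.maxCost : Program → ℕ
  | .skip => 1
  | .setIdx _ i e => i.cost + e.cost + 1
  | .setReal _ i e => i.cost + e.cost + 1
  | .emit q p => q.cost + p.cost + 1
  | .seq c₁ c₂ => c₁.maxCost + c₂.maxCost
  | .ite b c₁ c₂ => b.cost + (c₁.maxCost + c₂.maxCost) + 1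
  | .loop _ _ => 0

theorem Program.LoopFree.reach {O : Oracle} {c : Program} (h : c.LoopFree) (s : State) :
    Reach O c s (c.run O s) c.maxCost := by
  induction c generalizing s with
  | skip => exact ⟨_, le_rfl, .skip s⟩
  | setIdx a i e => exact ⟨_, le_rfl, .setIdx a i e s⟩
  | setReal a i e => exact ⟨_, le_rfl, .setReal a i e s⟩
  | emit q p => exact ⟨_, le_rfl, .emit q p s⟩
  | seq c₁ c₂ ih₁ ih₂ => exact (ih₁ h.1 s).seq (ih₂ h.2 _)
  | ite b c₁ c₂ ih₁ ih₂ =>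
    unfold Program.run Program.maxCost
    split_ifs with hb
    · obtain ⟨t, ht, he⟩ := ih₁ h.1 s
      exact ⟨_, by omega, .ite_true hb he⟩
    · obtain ⟨t, ht, he⟩ := ih₂ h.2 s
      exact ⟨_, by omega, .ite_false hb he⟩
  | loop b c => exact h.elim

theorem Reach.of_run {O : Oracle} {c : Program} {s s' : State} (h : c.LoopFree)
    (hs : c.run O s = s') : Reach O c s s' c.maxCost :=
  hs ▸ h.reach s

/-! ### Memory layout -/

/-- The contents of the memory, apart from the input: `m` is the discretization parameter, `l`, `a`,
`b` and `c` are counters, `arg` and `best` are the current pointer and value, `Q`, `P` and `Pi` hold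
the quantities, prices and profits of the grid items, and `F` and `C` hold the values and the
pointers of the dynamic program. -/
structure Memory where
  m : ℕ
  l : ℕ
  a : ℕ
  b : ℕ
  c : ℕ
  arg : ℕ
  best : ℝ
  Q : ℕ → ℝ
  P : ℕ → ℝ
  Pi : ℕ → ℝ
  F : ℕ → ℝ
  C : ℕ → ℕ
  out : List (ℝ × ℝ)

/-- The value `n` in cell `0` of an otherwise empty array. -/
def cell {α : Type} [Zero α] (n : α) (i : ℕ) : α := if i = 0 then n else 0

/-- The state with the memory `r` that results from the input `s₀`. -/
def Memory.toState (s₀ : State) (r : Memory) : State where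
  idx a := if a = 1 then cell r.m else if a = 2 then cell r.l else if a = 3 then cell r.a
    else if a = 4 then cell r.b else if a = 5 then cell r.c else if a = 6 then cell r.arg
    else if a = 7 then r.C else s₀.idx a
  real a := if a = 1 then cell r.best else if a = 2 then r.Q else if a = 3 then r.P
    else if a = 4 then r.Pi else if a = 5 then r.F else s₀.real a
  out := r.out

section Memory

variable (s₀ : State) (r : Memory)

@[simp] theorem cell_zero {α : Type} [Zero α] (n : α) : cell n 0 = n := rfl

@[simp] theorem update_cell {α : Type} [Zero α] (n k : α) :
    Function.update (cell n) 0 k = cell k := by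
  funext i
  by_cases h : i = 0 <;> simp [cell, Function.update, h]

@[simp] theorem Memory.idx_zero : (r.toState s₀).idx 0 = s₀.idx 0 := rfl
@[simp] theorem Memory.idx_m : (r.toState s₀).idx 1 = cell r.m := rfl
@[simp] theorem Memory.idx_l : (r.toState s₀).idx 2 = cell r.l := rfl
@[simp] theorem Memory.idx_a : (r.toState s₀).idx 3 = cell r.a := rfl
@[simp] theorem Memory.idx_b : (r.toState s₀).idx 4 = cell r.b := rfl
@[simp] theorem Memory.idx_c : (r.toState s₀).idx 5 = cell r.c := rfl
@[simp] theorem Memory.idx_arg : (r.toState s₀).idx 6 = cell r.arg := rfl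
@[simp] theorem Memory.idx_C : (r.toState s₀).idx 7 = r.C := rfl
@[simp] theorem Memory.real_zero : (r.toState s₀).real 0 = s₀.real 0 := rfl
@[simp] theorem Memory.real_best : (r.toState s₀).real 1 = cell r.best := rfl
@[simp] theorem Memory.real_Q : (r.toState s₀).real 2 = r.Q := rfl
@[simp] theorem Memory.real_P : (r.toState s₀).real 3 = r.P := rfl
@[simp] theorem Memory.real_Pi : (r.toState s₀).real 4 = r.Pi := rfl
@[simp] theorem Memory.real_F : (r.toState s₀).real 5 = r.F := rfl

@[simp] theorem Memory.emit (z : ℝ × ℝ) :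
    (r.toState s₀).emit z = Memory.toState s₀ { r with out := z :: r.out } := rfl

@[simp] theorem Memory.setIdx_m (n : ℕ) :
    (r.toState s₀).setIdx 1 0 n = Memory.toState s₀ { r with m := n } := by
  simp only [State.setIdx, Memory.toState, State.mk.injEq, and_true]
  funext a
  by_cases h : a = 1 <;> simp [Function.update, h]

@[simp] theorem Memory.setIdx_l (n : ℕ) :
    (r.toState s₀).setIdx 2 0 n = Memory.toState s₀ { r with l := n } := by
  simp only [State.setIdx, Memory.toState, State.mk.injEq, and_true]
  funext a
  by_cases h : a = 2 <;> simp [Function.update, h]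

@[simp] theorem Memory.setIdx_a (n : ℕ) :
    (r.toState s₀).setIdx 3 0 n = Memory.toState s₀ { r with a := n } := by
  simp only [State.setIdx, Memory.toState, State.mk.injEq, and_true]
  funext a
  by_cases h : a = 3 <;> simp [Function.update, h]

@[simp] theorem Memory.setIdx_b (n : ℕ) :
    (r.toState s₀).setIdx 4 0 n = Memory.toState s₀ { r with b := n } := by
  simp only [State.setIdx, Memory.toState, State.mk.injEq, and_true]
  funext a
  by_cases h : a = 4 <;> simp [Function.update, h]

@[simp] theorem Memory.setIdx_c (n : ℕ) :
    (r.toState s₀).setIdx 5 0 n = Memory.toState s₀ { r with c := n } := by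
  simp only [State.setIdx, Memory.toState, State.mk.injEq, and_true]
  funext a
  by_cases h : a = 5 <;> simp [Function.update, h]

@[simp] theorem Memory.setIdx_arg (n : ℕ) :
    (r.toState s₀).setIdx 6 0 n = Memory.toState s₀ { r with arg := n } := by
  simp only [State.setIdx, Memory.toState, State.mk.injEq, and_true]
  funext a
  by_cases h : a = 6 <;> simp [Function.update, h]

@[simp] theorem Memory.setIdx_C (i n : ℕ) :
    (r.toState s₀).setIdx 7 i n = Memory.toState s₀ { r with C := Function.update r.C i n } := by
  simp only [State.setIdx, Memory.toState, State.mk.injEq, and_true]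
  funext a
  by_cases h : a = 7 <;> simp [Function.update, h]

@[simp] theorem Memory.setReal_best (x : ℝ) :
    (r.toState s₀).setReal 1 0 x = Memory.toState s₀ { r with best := x } := by
  simp only [State.setReal, Memory.toState, State.mk.injEq, and_true, true_and]
  funext a
  by_cases h : a = 1 <;> simp [Function.update, h]

@[simp] theorem Memory.setReal_Q (i : ℕ) (x : ℝ) :
    (r.toState s₀).setReal 2 i x = Memory.toState s₀ { r with Q := Function.update r.Q i x } := by
  simp only [State.setReal, Memory.toState, State.mk.injEq, and_true, true_and]
  funext a
  by_cases h : a = 2 <;> simp [Function.update, h]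

@[simp] theorem Memory.setReal_P (i : ℕ) (x : ℝ) :
    (r.toState s₀).setReal 3 i x = Memory.toState s₀ { r with P := Function.update r.P i x } := by
  simp only [State.setReal, Memory.toState, State.mk.injEq, and_true, true_and]
  funext a
  by_cases h : a = 3 <;> simp [Function.update, h]

@[simp] theorem Memory.setReal_Pi (i : ℕ) (x : ℝ) :
    (r.toState s₀).setReal 4 i x =
      Memory.toState s₀ { r with Pi := Function.update r.Pi i x } := by
  simp only [State.setReal, Memory.toState, State.mk.injEq, and_true, true_and]
  funext a
  by_cases h : a = 4 <;> simp [Function.update, h]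

@[simp] theorem Memory.setReal_F (i : ℕ) (x : ℝ) :
    (r.toState s₀).setReal 5 i x = Memory.toState s₀ { r with F := Function.update r.F i x } := by
  simp only [State.setReal, Memory.toState, State.mk.injEq, and_true, true_and]
  funext a
  by_cases h : a = 5 <;> simp [Function.update, h]

end Memory

/-- The function `f` on the numbers below `j`, and `0` elsewhere. -/
def trunc {α : Type} [Zero α] (f : ℕ → α) (j i : ℕ) : α := if i < j then f i else 0

theorem trunc_of_lt {α : Type} [Zero α] {f : ℕ → α} {i j : ℕ} (h : i < j) :
    trunc f j i = f i := if_pos h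

theorem update_trunc {α : Type} [Zero α] {f : ℕ → α} {j : ℕ} {x : α} (h : x = f j) :
    Function.update (trunc f j) j x = trunc f (j + 1) := by
  funext i
  rcases lt_trichotomy i j with hi | rfl | hi
  · simp [trunc, Function.update, hi.ne, hi, hi.trans (Nat.lt_succ_self j)]
  · simp [trunc, h]
  · simp [trunc, Function.update, hi.ne', hi.not_gt, (Nat.lt_succ_iff.not.2 (not_le.2 hi))]

theorem trunc_eq_zero {α : Type} [Zero α] {f : ℕ → α} {j : ℕ} (h : ∀ i < j, f i = 0) :
    trunc f j = fun _ => 0 := by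
  funext i
  unfold trunc
  split_ifs with hi
  · exact h i hi
  · rfl

theorem trunc_succ {α : Type} [Zero α] {f : ℕ → α} {j : ℕ} (h : f j = 0) :
    trunc f j = trunc f (j + 1) := by
  rw [← update_trunc rfl, h]
  funext i
  by_cases hi : i = j <;> simp [trunc, Function.update, hi]

/-! ### The program -/

/-- The register in cell `0` of the `a`-th array of natural numbers. -/
abbrev IdxExpr.reg (a : ℕ) : IdxExpr := .get a (.const 0)

/-- `m * m` -/
abbrev squareExpr : IdxExpr := .mul (.reg 1) (.reg 1)

/-- The number of grid prices. -/
abbrev pricesExpr : IdxExpr := .add squareExpr (.const 2)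

/-- The number of grid items. -/
abbrev sizeExpr : IdxExpr := .mul pricesExpr (.add squareExpr (.const 1))

/-- The position of the entry `(l, a, b)` of the table. -/
abbrev posExpr (l a b : IdxExpr) : IdxExpr := .add (.mul (.add (.mul l sizeExpr) a) sizeExpr) b

/-- Increments a register. -/
abbrev incr (a : ℕ) : Program := .setIdx a (.const 0) (.add (.reg a) (.const 1))

/-- Sets a register to `0`. -/
abbrev reset (a : ℕ) : Program := .setIdx a (.const 0) (.const 0)

/-- `8 > m * ε` -/
def paramTest : Test :=
  .neg (.realLe (.const 8) (.mul (.cast (.reg 1)) (.get 0 (.const 1))))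

/-- Computes one item of the grid. -/
def gridBody : Program :=
  .seq (.ite (.idxLe pricesExpr (.reg 5))
    (.seq (.setReal 2 (.reg 5) (.add (.get 2 (.sub (.reg 5) pricesExpr))
        (.div (.const 1) (.cast squareExpr))))
      (.seq (.setReal 3 (.reg 5) (.get 3 (.sub (.reg 5) pricesExpr)))
        (.setReal 4 (.reg 5) (.sub (.get 3 (.reg 5)) (.get 0 (.const 2))))))
    (.seq (.setReal 3 (.reg 5) (.mul (.cast (.reg 5))
        (.div (.get 0 (.const 0)) (.cast squareExpr))))
      (.setReal 4 (.reg 5) (.get 3 (.reg 5))))) (incr 5)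

/-- A register has not yet reached the number of grid items. -/
abbrev sizeTest (a : ℕ) : Test := .neg (.idxLe sizeExpr (.reg a))

/-- The quantity of the grid item that a register points to. -/
abbrev quantityExpr (a : ℕ) : RealExpr := .get 2 (.reg a)

/-- The price of the grid item that a register points to. -/
abbrev priceExpr (a : ℕ) : RealExpr := .get 3 (.reg a)

/-- The cutoff between the grid items that two registers point to. -/
abbrev cutoffExpr (a b : ℕ) : RealExpr :=
  .cutoff (quantityExpr a) (priceExpr a) (quantityExpr b) (priceExpr b)

/-- The value of continuing with the item `c`. -/
abbrev valueExpr : RealExpr :=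
  .add (.mul (.sub (.get 4 (.reg 5)) (.get 4 (.reg 4))) (.tail (cutoffExpr 4 5)))
    (.get 5 (posExpr (.reg 2) (.reg 4) (.reg 5)))

/-- One step of the search for the best next item. -/
def scanBody : Program :=
  .seq (.ite (.both (.both (.neg (.realLe (quantityExpr 5) (quantityExpr 4)))
      (.realLe (cutoffExpr 3 4) (cutoffExpr 4 5))) (.neg (.realLe valueExpr (.get 1 (.const 0)))))
    (.seq (.setReal 1 (.const 0) valueExpr) (.setIdx 6 (.const 0) (.reg 5))) .skip) (incr 5)

/-- Stores the result of the search. -/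
def storeBody : Program :=
  .seq (.setReal 5 (posExpr (.add (.reg 2) (.const 1)) (.reg 3) (.reg 4)) (.get 1 (.const 0)))
    (.seq (.setIdx 7 (posExpr (.add (.reg 2) (.const 1)) (.reg 3) (.reg 4)) (.reg 6))
      (.seq (reset 5) (.seq (.setReal 1 (.const 0) (.const 0)) (.seq (reset 6) (incr 4)))))

/-- `b := 0; a := a + 1` -/
def nextBody : Program := .seq (reset 4) (incr 3)

/-- `a := 0; l := l + 1` -/
def levelBody : Program := .seq (reset 3) (incr 2)

/-- The number of levels that are available. -/
def levelsProgram : Program :=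
  .ite (.idxLe (.get 0 (.const 0)) (.const 0)) (.setIdx 2 (.const 0) squareExpr)
    (.ite (.idxLe (.get 0 (.const 1)) squareExpr) (.setIdx 2 (.const 0) (.get 0 (.const 1)))
      (.setIdx 2 (.const 0) squareExpr))

/-- The pointer of the current entry. -/
abbrev pointerExpr : IdxExpr := .get 7 (posExpr (.reg 2) (.reg 3) (.reg 4))

/-- There is a next item. -/
def traceTest : Test := .neg (.idxLe pointerExpr (.const 0))

/-- Writes the next item to the output. -/
def traceBody : Program :=
  .seq (.setIdx 5 (.const 0) pointerExpr) (.seq (.emit (quantityExpr 5) (priceExpr 5))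
    (.seq (.setIdx 3 (.const 0) (.reg 4)) (.seq (.setIdx 4 (.const 0) (.reg 5))
      (.setIdx 2 (.const 0) (.sub (.reg 2) (.const 1))))))

/-- Computes one entry of the table. -/
def rowProgram : Program := .seq (.loop (sizeTest 5) scanBody) storeBody

/-- Computes the entries `(l + 1, a, b)` for all `b`. -/
def planeProgram : Program := .seq (.loop (sizeTest 4) rowProgram) nextBody

/-- Computes the entries `(l + 1, a, b)` for all `a` and `b`. -/
def levelProgram : Program := .seq (.loop (sizeTest 3) planeProgram) levelBody

/-- There are levels of the table left to compute. -/
def levelTest : Test := .neg (.idxLe squareExpr (.reg 2))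

/-- Discretize, run the dynamic program, and follow its pointers. -/
def pricingProgram : Program :=
  .seq (.loop paramTest (incr 1)) (.seq (.loop (sizeTest 5) gridBody) (.seq (reset 5)
    (.seq (.loop levelTest levelProgram) (.seq levelsProgram (.loop traceTest traceBody)))))

/-! ### Loop invariants for the grid and the table. -/

section Correctness

variable (I : Instance) (lam ε : ℝ) (k : ℕ∞) (m : ℕ)

/-- The memory while the grid is computed. -/
noncomputable def gridMemory (j : ℕ) : Memory where
  m := m
  l := 0
  a := 0
  b := 0
  c := j
  arg := 0
  best := 0
  Q := trunc (fun i => (gridItem lam m i).1) j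
  P := trunc (fun i => (gridItem lam m i).2) j
  Pi := trunc (fun i => I.profit (gridItem lam m i)) j
  F := fun _ => 0
  C := fun _ => 0
  out := []

/-- The table of the dynamic program, as one array. -/
noncomputable def flatTable (i : ℕ) : ℝ × ℕ :=
  I.dp lam m (i / gridSize m / gridSize m) (i / gridSize m % gridSize m) (i % gridSize m)

/-- The memory while the dynamic program is running: `s` is the state of the search for the best
next item, and the first `x` entries of the table have been computed. -/
noncomputable def tableMemory (l a b c : ℕ) (s : ℝ × ℕ) (x : ℕ) (out : List (ℝ × ℝ)) : Memory where
  m := m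
  l := l
  a := a
  b := b
  c := c
  arg := s.2
  best := s.1
  Q := trunc (fun i => (gridItem lam m i).1) (gridSize m)
  P := trunc (fun i => (gridItem lam m i).2) (gridSize m)
  Pi := trunc (fun i => I.profit (gridItem lam m i)) (gridSize m)
  F := trunc (fun i => (flatTable I lam m i).1) x
  C := trunc (fun i => (flatTable I lam m i).2) x
  out := out

theorem flatTable_pos {l a b : ℕ} (ha : a < gridSize m) (hb : b < gridSize m) :
    flatTable I lam m ((l * gridSize m + a) * gridSize m + b) = I.dp lam m l a b := by
  have h0 := gridSize_pos m
  have h1 : ((l * gridSize m + a) * gridSize m + b) / gridSize m = l * gridSize m + a := by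
    rw [mul_comm _ (gridSize m), Nat.mul_add_div h0, Nat.div_eq_of_lt hb, add_zero]
  have h2 : ((l * gridSize m + a) * gridSize m + b) % gridSize m = b := by
    rw [mul_comm _ (gridSize m), Nat.mul_add_mod, Nat.mod_eq_of_lt hb]
  have h3 : (l * gridSize m + a) / gridSize m = l := by
    rw [mul_comm _ (gridSize m), Nat.mul_add_div h0, Nat.div_eq_of_lt ha, add_zero]
  have h4 : (l * gridSize m + a) % gridSize m = a := by
    rw [mul_comm _ (gridSize m), Nat.mul_add_mod, Nat.mod_eq_of_lt ha]
  unfold flatTable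
  rw [h1, h2, h3, h4]

/-- Level 0 of the table is identically zero, so zero-initialized memory already contains it and the
loop starts at level 1. -/
theorem flatTable_of_lt {i : ℕ} (hi : i < gridSize m * gridSize m) :
    flatTable I lam m i = (0, 0) := by
  unfold flatTable
  rw [Nat.div_div_eq_div_mul, Nat.div_eq_of_lt hi]
  rfl

theorem gridItem_of_lt {j : ℕ} (h : j < gridPrices m) :
    gridItem lam m j = (0, j * (lam / (m : ℝ) ^ 2)) := by
  unfold gridItem
  rw [Nat.div_eq_of_lt h, Nat.mod_eq_of_lt h]
  simp

/-- The machine has no integer division; this recursion lets it compute grid items by shifting the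
index by one block of prices. -/
theorem gridItem_of_le {j : ℕ} (h : gridPrices m ≤ j) :
    gridItem lam m j = ((gridItem lam m (j - gridPrices m)).1 + 1 / (m : ℝ) ^ 2,
      (gridItem lam m (j - gridPrices m)).2) := by
  have h0 : 0 < gridPrices m := by unfold gridPrices; omega
  unfold gridItem
  rw [Nat.div_eq_sub_div h0 h, Nat.mod_eq_sub_mod h]
  push_cast
  rw [add_div]

theorem grid_step (hm : 0 < m) {j : ℕ} (hj : j < gridSize m) :
    gridBody.run I.oracle ((gridMemory I lam m j).toState (input lam ε I.cost k)) =
      (gridMemory I lam m (j + 1)).toState (input lam ε I.cost k) := by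
  have hm' : (0 : ℝ) < (m : ℝ) ^ 2 := by positivity
  by_cases h : gridPrices m ≤ j
  · have h0 : 0 < gridPrices m := by unfold gridPrices; omega
    have hsub : j - gridPrices m < j := by omega
    have hq := gridItem_of_le lam m h
    have hprofit : I.profit (gridItem lam m j) =
        (gridItem lam m (j - gridPrices m)).2 - I.cost := by
      have hnn := (gridItem_quantity_mem lam hm (hsub.trans hj)).1
      rw [I.profit_of_pos, hq]
      rw [hq]
      positivity
    have h' : m * m + 2 ≤ j := h
    have e : j - (m * m + 2) = j - gridPrices m := rfl
    simp only [gridBody, Program.run, IdxExpr.eval, Test.Holds, Memory.idx_m, Memory.idx_c,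
      cell_zero, gridMemory, RealExpr.eval, Memory.setReal_Q, Memory.setReal_P, Memory.setReal_Pi,
      Memory.real_Q, Memory.real_P, Memory.real_zero, Memory.setIdx_c, if_pos h', e,
      trunc_of_lt hsub, Function.update_self]
    congr 2
    · exact update_trunc (by rw [hq]; push_cast; rw [sq])
    · exact update_trunc (by rw [hq])
    · exact update_trunc (by rw [hprofit]; simp [input])
  · have h' : ¬ m * m + 2 ≤ j := h
    have hq := gridItem_of_lt lam m (not_le.1 h)
    simp only [gridBody, Program.run, IdxExpr.eval, Test.Holds, Memory.idx_m, Memory.idx_c,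
      cell_zero, gridMemory, RealExpr.eval, Memory.setReal_P, Memory.setReal_Pi,
      Memory.real_P, Memory.real_zero, Memory.setIdx_c, if_neg h', Function.update_self]
    congr 2
    · exact trunc_succ (by rw [hq])
    · exact update_trunc (by rw [hq]; simp [input, sq])
    · exact update_trunc (by rw [hq]; simp [input, sq, Instance.profit])

theorem scan_step {l a b c : ℕ} (ha : a < gridSize m) (hb : b < gridSize m)
    (hc : c < gridSize m) {x : ℕ} (hx : (l + 1) * gridSize m * gridSize m ≤ x) :
    scanBody.run I.oracle ((tableMemory I lam m l a b c (scan (I.MayFollow lam m a b)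
        (fun c => I.gain lam m b c + (I.dp lam m l b c).1) c) x []).toState
          (input lam ε I.cost k)) =
      (tableMemory I lam m l a b (c + 1) (scan (I.MayFollow lam m a b)
        (fun c => I.gain lam m b c + (I.dp lam m l b c).1) (c + 1)) x []).toState
          (input lam ε I.cost k) := by
  -- The entry read by the search belongs to level `l`, which is complete.
  have hlt : (l * gridSize m + b) * gridSize m + c < x := by
    refine lt_of_lt_of_le ?_ hx
    nlinarith
  have hN : (m * m + 2) * (m * m + 1) = gridSize m := rfl
  simp only [scanBody, Program.run, IdxExpr.eval, Test.Holds, RealExpr.eval, Memory.idx_m,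
    Memory.idx_l, Memory.idx_a, Memory.idx_b, Memory.idx_c, cell_zero, tableMemory,
    Memory.real_Q, Memory.real_P, Memory.real_Pi, Memory.real_F, Memory.real_best, hN,
    trunc_of_lt ha, trunc_of_lt hb, trunc_of_lt hc, trunc_of_lt hlt, flatTable_pos I lam m hb hc]
  conv_rhs => unfold scan
  split_ifs with h1 h2 h2
  · simp [Instance.gain]
  · exact absurd ⟨⟨not_le.1 h1.1.1, h1.1.2⟩, h1.2⟩ h2
  · exact absurd ⟨⟨not_le.2 h2.1.1, h2.1.2⟩, h2.2⟩ h1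
  · simp

theorem store_step {l a b : ℕ} (ha : a < gridSize m) (hb : b < gridSize m) :
    storeBody.run I.oracle ((tableMemory I lam m l a b (gridSize m) (I.dp lam m (l + 1) a b)
        (((l + 1) * gridSize m + a) * gridSize m + b) []).toState (input lam ε I.cost k)) =
      (tableMemory I lam m l a (b + 1) 0 (0, 0)
        (((l + 1) * gridSize m + a) * gridSize m + (b + 1)) []).toState
          (input lam ε I.cost k) := by
  have hN : (m * m + 2) * (m * m + 1) = gridSize m := rfl
  simp only [storeBody, Program.run, IdxExpr.eval, RealExpr.eval, Memory.idx_m,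
    Memory.idx_l, Memory.idx_a, Memory.idx_b, Memory.idx_arg, cell_zero, tableMemory,
    Memory.real_best, hN, Memory.setReal_F, Memory.setIdx_C, Memory.setIdx_c, Memory.setIdx_arg,
    Memory.setIdx_b, Memory.setReal_best, Nat.cast_zero]
  congr 2
  · exact update_trunc (by rw [flatTable_pos I lam m ha hb])
  · exact update_trunc (by rw [flatTable_pos I lam m ha hb])

theorem sizeTest_holds (O : Oracle) (s₀ : State) (r : Memory) :
    ((sizeTest 3).Holds O (r.toState s₀) ↔ r.a < gridSize r.m) ∧
    ((sizeTest 4).Holds O (r.toState s₀) ↔ r.b < gridSize r.m) ∧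
    ((sizeTest 5).Holds O (r.toState s₀) ↔ r.c < gridSize r.m) :=
  ⟨not_le, not_le, not_le⟩

/-- The number of steps of a loop of `B` rounds with tests of cost `b` and bodies of cost `T`. -/
def loopTime (B b T : ℕ) : ℕ := B * (b + T + 1) + (b + 1)

/-- A bound on the number of steps of `rowProgram`. -/
def rowTime : ℕ := loopTime (gridSize m) (sizeTest 5).cost scanBody.maxCost + storeBody.maxCost

/-- A bound on the number of steps of `planeProgram`. -/
def planeTime : ℕ := loopTime (gridSize m) (sizeTest 4).cost (rowTime m) + nextBody.maxCost

/-- A bound on the number of steps of `levelProgram`. -/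
def levelTime : ℕ := loopTime (gridSize m) (sizeTest 3).cost (planeTime m) + levelBody.maxCost

theorem row_reach {l a b : ℕ} (ha : a < gridSize m) (hb : b < gridSize m) :
    Reach I.oracle rowProgram
      ((tableMemory I lam m l a b 0 (0, 0) (((l + 1) * gridSize m + a) * gridSize m + b)
        []).toState (input lam ε I.cost k))
      ((tableMemory I lam m l a (b + 1) 0 (0, 0)
        (((l + 1) * gridSize m + a) * gridSize m + (b + 1)) []).toState (input lam ε I.cost k))
      (rowTime m) := by
  refine Reach.seq (Reach.loop (fun c => (tableMemory I lam m l a b c (scan (I.MayFollow lam m a b)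
        (fun c => I.gain lam m b c + (I.dp lam m l b c).1) c)
        (((l + 1) * gridSize m + a) * gridSize m + b) []).toState (input lam ε I.cost k))
        (gridSize m) (fun j _ => (sizeTest_holds _ _ _).2.2) fun c hc => ?_)
    (Reach.of_run (by simp [storeBody, Program.LoopFree]) (store_step I lam ε k m ha hb))
  refine Reach.of_run (by simp [scanBody, Program.LoopFree]) (scan_step I lam ε k m ha hb hc ?_)
  nlinarith

theorem plane_reach {l a : ℕ} (ha : a < gridSize m) :
    Reach I.oracle planeProgram
      ((tableMemory I lam m l a 0 0 (0, 0) (((l + 1) * gridSize m + a) * gridSize m)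
        []).toState (input lam ε I.cost k))
      ((tableMemory I lam m l (a + 1) 0 0 (0, 0)
        (((l + 1) * gridSize m + (a + 1)) * gridSize m) []).toState (input lam ε I.cost k))
      (planeTime m) := by
  refine Reach.seq (Reach.loop (fun b => (tableMemory I lam m l a b 0 (0, 0)
        (((l + 1) * gridSize m + a) * gridSize m + b) []).toState (input lam ε I.cost k))
        (gridSize m) (fun j _ => (sizeTest_holds _ _ _).2.1)
        fun b hb => row_reach I lam ε k m ha hb)
    (Reach.of_run (by simp [nextBody, Program.LoopFree]) ?_)
  simp [nextBody, Program.run, IdxExpr.eval, tableMemory]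
  ring_nf

theorem level_reach {l : ℕ} :
    Reach I.oracle levelProgram
      ((tableMemory I lam m l 0 0 0 (0, 0) ((l + 1) * gridSize m * gridSize m)
        []).toState (input lam ε I.cost k))
      ((tableMemory I lam m (l + 1) 0 0 0 (0, 0)
        ((l + 1 + 1) * gridSize m * gridSize m) []).toState (input lam ε I.cost k))
      (levelTime m) := by
  refine Reach.seq (Reach.loop (fun a => (tableMemory I lam m l a 0 0 (0, 0)
        (((l + 1) * gridSize m + a) * gridSize m) []).toState (input lam ε I.cost k))
        (gridSize m) (fun j _ => (sizeTest_holds _ _ _).1)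
        fun a ha => plane_reach I lam ε k m ha)
    (Reach.of_run (by simp [levelBody, Program.LoopFree]) ?_)
  simp [levelBody, Program.run, IdxExpr.eval, tableMemory]
  ring_nf

end Correctness

/-! ### Following the pointers, and the total running time. -/

section Total

variable (I : Instance) (lam ε : ℝ) (k : ℕ∞) (m : ℕ)

theorem dp_snd_lt (l a b : ℕ) : (I.dp lam m l a b).2 < gridSize m := by
  cases l with
  | zero => exact gridSize_pos m
  | succ l =>
    rcases scan_cases (valid := I.MayFollow lam m a b)
      (val := fun c => I.gain lam m b c + (I.dp lam m l b c).1) (gridSize m) with h | h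
    · unfold Instance.dp
      rw [h]
      exact gridSize_pos m
    · exact h.1

theorem pos_lt {l a b : ℕ} (hl : l ≤ m * m) (ha : a < gridSize m) (hb : b < gridSize m) :
    (l * gridSize m + a) * gridSize m + b < (m * m + 1) * gridSize m * gridSize m := by
  have h1 : (l + 1) * gridSize m ≤ (m * m + 1) * gridSize m := by gcongr
  have h2 : l * gridSize m + a + 1 ≤ (m * m + 1) * gridSize m := by linarith
  nlinarith

theorem eval_pointer {l a b c x : ℕ} {s : ℝ × ℕ} {out : List (ℝ × ℝ)}
    (hx : (l * gridSize m + a) * gridSize m + b < x) (ha : a < gridSize m)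
    (hb : b < gridSize m) (s₀ : State) :
    pointerExpr.eval ((tableMemory I lam m l a b c s x out).toState s₀) =
      (I.dp lam m l a b).2 := by
  have hN : (m * m + 2) * (m * m + 1) = gridSize m := rfl
  simp only [IdxExpr.eval, Memory.idx_m, Memory.idx_l, Memory.idx_a, Memory.idx_b, cell_zero,
    tableMemory, Memory.idx_C, hN, trunc_of_lt hx, flatTable_pos I lam m ha hb]

theorem trace_step {l a b c x : ℕ} {out : List (ℝ × ℝ)}
    (hx : (l * gridSize m + a) * gridSize m + b < x) (ha : a < gridSize m)
    (hb : b < gridSize m) (s₀ : State) :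
    traceBody.run I.oracle ((tableMemory I lam m l a b c (0, 0) x out).toState s₀) =
      (tableMemory I lam m (l - 1) b (I.dp lam m l a b).2 (I.dp lam m l a b).2 (0, 0) x
        (gridItem lam m (I.dp lam m l a b).2 :: out)).toState s₀ := by
  simp only [traceBody, Program.run, eval_pointer I lam m hx ha hb]
  simp only [IdxExpr.eval, RealExpr.eval, Memory.idx_l, Memory.idx_b, Memory.idx_c, cell_zero,
    tableMemory, Memory.setIdx_c, Memory.real_Q, Memory.real_P, Memory.emit, Memory.setIdx_a,
    Memory.setIdx_b, Memory.setIdx_l, trunc_of_lt (dp_snd_lt I lam m l a b)]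

/-- Each round lowers `l`, and the pointers at level 0 vanish, so there are at most `l` rounds.
Items are prepended to the output, hence the reversal. -/
theorem trace_reach (s₀ : State) {l a b c : ℕ} (hl : l ≤ m * m) (ha : a < gridSize m)
    (hb : b < gridSize m) (out : List (ℝ × ℝ)) :
    ∃ s : State, s.out = (I.trace lam m l a b).reverse ++ out ∧
      Reach I.oracle (.loop traceTest traceBody)
        ((tableMemory I lam m l a b c (0, 0) ((m * m + 1) * gridSize m * gridSize m)
          out).toState s₀) s (loopTime l traceTest.cost traceBody.maxCost) := by
  have hdone : ∀ {l a b c : ℕ} (out : List (ℝ × ℝ)), l ≤ m * m → a < gridSize m →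
      b < gridSize m → (I.dp lam m l a b).2 = 0 → Reach I.oracle (.loop traceTest traceBody)
        ((tableMemory I lam m l a b c (0, 0) ((m * m + 1) * gridSize m * gridSize m)
          out).toState s₀) ((tableMemory I lam m l a b c (0, 0)
            ((m * m + 1) * gridSize m * gridSize m) out).toState s₀)
        (loopTime l traceTest.cost traceBody.maxCost) := by
    intro l a b c out hl ha hb h
    refine ⟨_, Nat.le_add_left _ _, .loop_false (not_not.2 ?_)⟩
    change pointerExpr.eval _ ≤ 0
    rw [eval_pointer I lam m (pos_lt m hl ha hb) ha hb, h]
  induction l generalizing a b c out with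
  | zero => exact ⟨_, rfl, hdone out hl ha hb rfl⟩
  | succ l ih =>
    by_cases h : (I.dp lam m (l + 1) a b).2 = 0
    · exact ⟨_, by simp [Instance.trace, h, tableMemory, Memory.toState], hdone out hl ha hb h⟩
    · obtain ⟨s, hs, t₂, ht₂, h₂⟩ := ih (a := b) (b := (I.dp lam m (l + 1) a b).2)
        (c := (I.dp lam m (l + 1) a b).2) (by omega) hb (dp_snd_lt I lam m _ _ _)
        (gridItem lam m (I.dp lam m (l + 1) a b).2 :: out)
      have hbody := trace_step I lam m (c := c) (out := out) (pos_lt m hl ha hb) ha hb s₀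
      obtain ⟨t₁, ht₁, h₁⟩ := Reach.of_run (by simp [traceBody, Program.LoopFree]) hbody
      refine ⟨s, by simp [hs, Instance.trace, h], _, ?_, .loop_true ?_ h₁ h₂⟩
      · unfold loopTime at ht₂ ⊢
        rw [add_mul]
        omega
      · change ¬ pointerExpr.eval _ ≤ 0
        rw [eval_pointer I lam m (pos_lt m hl ha hb) ha hb]
        omega

/-- The number of levels that the output may use. -/
noncomputable def levels : ℕ := if k = ⊤ then m * m else min k.toNat (m * m)

theorem levels_step {x : ℕ} :
    levelsProgram.run I.oracle ((tableMemory I lam m (m * m) 0 0 0 (0, 0) x []).toState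
        (input lam ε I.cost k)) =
      (tableMemory I lam m (levels k m) 0 0 0 (0, 0) x []).toState (input lam ε I.cost k) := by
  have h0 : (input lam ε I.cost k).idx 0 0 = if k = ⊤ then 0 else 1 := rfl
  have h1 : (input lam ε I.cost k).idx 0 1 = k.toNat := rfl
  simp only [levelsProgram, Program.run, Test.Holds, IdxExpr.eval, Memory.idx_zero,
    Memory.idx_m, cell_zero, tableMemory, Memory.setIdx_l, h0, h1, levels]
  by_cases hk : k = ⊤
  · simp [hk]
  · by_cases hle : k.toNat ≤ m * m
    · simp [hk, hle]
    · simp [hk, hle, (not_le.1 hle).le]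

/-- A bound on the total number of steps. -/
def totalTime : ℕ :=
  loopTime m paramTest.cost (incr 1).maxCost +
    (loopTime (gridSize m) (sizeTest 5).cost gridBody.maxCost + ((reset 5).maxCost +
      (loopTime (m * m) levelTest.cost (levelTime m) + (levelsProgram.maxCost +
        loopTime (m * m) traceTest.cost traceBody.maxCost))))

/-- With no grid item stored yet, the degenerate parameter `m = 0` is harmless, so the invariant of
the first loop begins at the input itself. -/
theorem input_eq (cost : ℝ) :
    (gridMemory I lam 0 0).toState (input lam ε cost k) = input lam ε cost k := by
  have hc : ∀ {α : Type} [Zero α], cell (0 : α) = fun _ => 0 := by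
    intro α _
    funext i
    simp [cell]
  have ht : ∀ {α : Type} [Zero α] (f : ℕ → α), trunc f 0 = fun _ => 0 :=
    fun f => trunc_eq_zero (by simp)
  simp only [Memory.toState, gridMemory, hc, ht]
  unfold input
  congr 1
  · funext a i
    by_cases h : a = 0
    · simp [h]
    · simp [h]
  · funext a i
    by_cases h : a = 0
    · simp [h]
    · simp [h]

theorem pricingProgram_reach (hε : 0 < ε) :
    ∃ s : State, s.menu = {z | z ∈ I.trace lam ⌈8 / ε⌉₊ (levels k ⌈8 / ε⌉₊) 0 0} ∧
      Reach I.oracle pricingProgram (input lam ε I.cost k) s (totalTime ⌈8 / ε⌉₊) := by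
  set m := ⌈8 / ε⌉₊ with hm
  have hmpos : 0 < m := Nat.ceil_pos.2 (by positivity)
  have hlev : levels k m ≤ m * m := by
    unfold levels
    split_ifs
    · exact le_rfl
    · exact min_le_right _ _
  obtain ⟨s, hs, htrace⟩ := trace_reach I lam m (input lam ε I.cost k) (c := 0) hlev
    (gridSize_pos m) (gridSize_pos m) []
  refine ⟨s, by simp [State.menu, hs], ?_⟩
  have hparam : Reach I.oracle (.loop paramTest (incr 1)) (input lam ε I.cost k)
      ((gridMemory I lam m 0).toState (input lam ε I.cost k))
      (loopTime m paramTest.cost (incr 1).maxCost) := by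
    have := Reach.loop (O := I.oracle) (b := paramTest) (c := incr 1) (T := (incr 1).maxCost)
      (fun j => (gridMemory I lam j 0).toState (input lam ε I.cost k)) m (fun j _ => ?_)
      (fun j _ => ?_)
    · rw [input_eq] at this
      exact this
    -- Counting up while `m * ε < 8` computes ⌈8 / ε⌉ without a rounding operation.
    · rw [hm, Nat.lt_ceil, lt_div_iff₀ hε]
      simp [paramTest, Test.Holds, RealExpr.eval, IdxExpr.eval, gridMemory, input]
    · refine Reach.of_run (by simp [Program.LoopFree]) ?_
      have ht : ∀ {α : Type} [Zero α] (f : ℕ → α), trunc f 0 = fun _ => 0 :=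
        fun f => trunc_eq_zero (by simp)
      simp [Program.run, IdxExpr.eval, gridMemory, ht]
  have hgrid := Reach.loop (fun j => (gridMemory I lam m j).toState (input lam ε I.cost k))
    (gridSize m) (fun j _ => (sizeTest_holds I.oracle _ _).2.2)
    (fun j hj => Reach.of_run (by simp [gridBody, Program.LoopFree])
      (grid_step I lam ε k m hmpos hj))
  have hreset : Reach I.oracle (reset 5)
      ((gridMemory I lam m (gridSize m)).toState (input lam ε I.cost k))
      ((tableMemory I lam m 0 0 0 0 (0, 0) ((0 + 1) * gridSize m * gridSize m) []).toState
        (input lam ε I.cost k)) (reset 5).maxCost := by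
    refine Reach.of_run (by simp [Program.LoopFree]) ?_
    simp only [Program.run, IdxExpr.eval, gridMemory, tableMemory, Memory.setIdx_c]
    rw [zero_add, one_mul, trunc_eq_zero (f := fun i => (flatTable I lam m i).1) fun i hi => by
      rw [flatTable_of_lt I lam m hi], trunc_eq_zero (f := fun i => (flatTable I lam m i).2)
      fun i hi => by rw [flatTable_of_lt I lam m hi]]
  have hdp := Reach.loop (b := levelTest) (fun l => (tableMemory I lam m l 0 0 0 (0, 0)
    ((l + 1) * gridSize m * gridSize m) []).toState (input lam ε I.cost k)) (m * m)
    (fun j _ => not_le) (fun j _ => level_reach I lam ε k m)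
  have hlevels := Reach.of_run (by simp [levelsProgram, Program.LoopFree])
    (levels_step I lam ε k m (x := (m * m + 1) * gridSize m * gridSize m))
  refine hparam.seq (hgrid.seq (hreset.seq (hdp.seq (hlevels.seq (htrace.mono ?_)))))
  unfold loopTime
  gcongr

end Total

/-! ### Polynomial running time -/

theorem exists_polynomial_totalTime :
    ∃ p : Polynomial ℕ, ∀ m, totalTime m = p.eval m := by
  have hsize : ∃ p : Polynomial ℕ, ∀ m, gridSize m = p.eval m :=
    ⟨(.X * .X + 2) * (.X * .X + 1), fun m => by simp [gridSize, gridPrices]⟩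
  have hloop : ∀ (B T : ℕ → ℕ) (b : ℕ), (∃ p : Polynomial ℕ, ∀ m, B m = p.eval m) →
      (∃ p : Polynomial ℕ, ∀ m, T m = p.eval m) →
      ∃ p : Polynomial ℕ, ∀ m, loopTime (B m) b (T m) = p.eval m := by
    rintro B T b ⟨p, hp⟩ ⟨q, hq⟩
    exact ⟨p * (.C b + q + 1) + (.C b + 1), fun m => by simp [loopTime, hp, hq]⟩
  have hadd : ∀ (S T : ℕ → ℕ), (∃ p : Polynomial ℕ, ∀ m, S m = p.eval m) →
      (∃ p : Polynomial ℕ, ∀ m, T m = p.eval m) →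
      ∃ p : Polynomial ℕ, ∀ m, S m + T m = p.eval m := by
    rintro S T ⟨p, hp⟩ ⟨q, hq⟩
    exact ⟨p + q, fun m => by simp [hp, hq]⟩
  have hconst : ∀ T : ℕ, ∃ p : Polynomial ℕ, ∀ m, T = p.eval m :=
    fun T => ⟨.C T, fun m => by simp⟩
  have hid : ∃ p : Polynomial ℕ, ∀ m, m = p.eval m := ⟨.X, fun m => by simp⟩
  have hsq : ∃ p : Polynomial ℕ, ∀ m, m * m = p.eval m := ⟨.X * .X, fun m => by simp⟩
  have hrow := hadd _ _ (hloop _ _ (sizeTest 5).cost hsize (hconst scanBody.maxCost))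
    (hconst storeBody.maxCost)
  have hplane := hadd _ _ (hloop _ _ (sizeTest 4).cost hsize hrow) (hconst nextBody.maxCost)
  have hlevel := hadd _ _ (hloop _ _ (sizeTest 3).cost hsize hplane) (hconst levelBody.maxCost)
  exact hadd _ _ (hloop _ _ paramTest.cost hid (hconst (incr 1).maxCost))
    (hadd _ _ (hloop _ _ (sizeTest 5).cost hsize (hconst gridBody.maxCost))
      (hadd _ _ (hconst (reset 5).maxCost) (hadd _ _ (hloop _ _ levelTest.cost hsq hlevel)
        (hadd _ _ (hconst levelsProgram.maxCost)
          (hloop _ _ traceTest.cost hsq (hconst traceBody.maxCost))))))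

/-- Natural coefficients make the polynomial monotone on nonnegative arguments. -/
theorem cast_eval_le_eval₂ (p : Polynomial ℕ) {n : ℕ} {x : ℝ} (h : (n : ℝ) ≤ x) :
    ((p.eval n : ℕ) : ℝ) ≤ p.eval₂ (Nat.castRingHom ℝ) x := by
  rw [Polynomial.eval_eq_sum_range, Polynomial.eval₂_eq_sum_range]
  push_cast
  gcongr

end NonlinearPricing

theorem mainTheorem2 :
    ∃ (A : NonlinearPricing.Program) (P : MvPolynomial (Fin 2) ℝ),
      ∀ (I : NonlinearPricing.Instance) (lam ε : ℝ) (k : ℕ∞),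
        0 < lam → I.MarginalBound lam → 0 < ε →
        ∃ (s : NonlinearPricing.State) (t : ℕ),
          NonlinearPricing.Exec I.oracle A (NonlinearPricing.input lam ε I.cost k) s t ∧
          (t : ℝ) ≤ MvPolynomial.eval ![lam, 1 / ε] P ∧
          NonlinearPricing.IsMenu s.menu ∧
          NonlinearPricing.HasAtMostLevels s.menu k ∧
          (∃ r, I.IsRevenue s.menu r) ∧
          BddAbove (I.revenues k) ∧
          ∀ r, I.IsRevenue s.menu r → I.opt k - lam * ε ≤ r := by
  obtain ⟨p, hp⟩ := NonlinearPricing.exists_polynomial_totalTime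
  refine ⟨NonlinearPricing.pricingProgram,
    -- The variable `X 1` stands for 1 / ε, and ⌈8 / ε⌉ ≤ 8 / ε + 1; the bound does not involve
    -- `lam`.
    p.eval₂ (Nat.castRingHom _) (MvPolynomial.C 8 * MvPolynomial.X 1 + 1), ?_⟩
  intro I lam ε k hlam h hε
  obtain ⟨s, hs, t, ht, hexec⟩ := NonlinearPricing.pricingProgram_reach I lam ε k hε
  have hm : 0 < ⌈8 / ε⌉₊ := Nat.ceil_pos.2 (by positivity)
  obtain ⟨h1, h2, h3, h4⟩ := NonlinearPricing.Instance.trace_spec h hlam hm (k := k)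
    (L := NonlinearPricing.levels k ⌈8 / ε⌉₊) (by
      unfold NonlinearPricing.levels
      split_ifs with hk
      · rw [hk]; exact le_top
      · refine (Nat.cast_le.2 (min_le_left _ _)).trans ?_
        rw [ENat.natCast_toNat hk]) (by
      intro j hj hjm
      unfold NonlinearPricing.levels
      split_ifs with hk
      · exact hjm
      · refine le_min ?_ hjm
        rw [← ENat.natCast_toNat hk] at hj
        exact_mod_cast hj)
  rw [← hs] at h1 h2 h3 h4
  refine ⟨s, t, hexec, ?_, h1, h2, h3, I.bddAbove_revenues h hlam k, fun r hr => ?_⟩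
  · have hle : ((⌈8 / ε⌉₊ : ℕ) : ℝ) ≤ 8 * (1 / ε) + 1 := by
      have := (Nat.ceil_lt_add_one (show (0 : ℝ) ≤ 8 / ε by positivity)).le
      rwa [mul_one_div]
    rw [Polynomial.hom_eval₂]
    have hcast : (MvPolynomial.eval ![lam, 1 / ε]).comp
        (Nat.castRingHom (MvPolynomial (Fin 2) ℝ)) = Nat.castRingHom ℝ := Subsingleton.elim _ _
    rw [hcast]
    refine le_trans ?_ ((NonlinearPricing.cast_eval_le_eval₂ p hle).trans (le_of_eq ?_))
    · rw [← hp]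
      exact_mod_cast ht
    · simp
  · refine le_trans ?_ (h4 r hr)
    have h5 : 8 / ε ≤ ((⌈8 / ε⌉₊ : ℕ) : ℝ) := Nat.le_ceil _
    have hm' : (0 : ℝ) < ((⌈8 / ε⌉₊ : ℕ) : ℝ) := by exact_mod_cast hm
    rw [div_le_iff₀ hε] at h5
    have h6 : 8 * (lam / ((⌈8 / ε⌉₊ : ℕ) : ℝ)) ≤ lam * ε := by
      rw [← mul_div_assoc, div_le_iff₀ hm']
      nlinarith
    linarith
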